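/- **Definitions.** Let $G=(V,E)$ be a finite graph, $p\in(0,1)$ and $q>1$. A random-cluster configuration is a subset $A\subseteq E$, and the random-cluster measure is $$\mu(A)=\mu_{G,p,q}(A)=\frac1Z\,p^{|A|}(1-p)^{|E|-|A|}q^{c(A)},$$ where $c(A)$ is the number of connected components of $(V,A)$ and $Z$ is the normalizing constant. One step of the (heat-bath) *Glauber dynamics* (GD) from $A$ picks $e\in E$ uniformly at random and moves to $A\cup\{e\}$ with probability $\frac{\mu(A\cup\{e\})}{\mu(A\cup\{e\})+\mu(A\setminus\{e\})}$, and otherwise to $A\setminus\{e\}$. One step of the *Chayes–Machta dynamics* (CM) from $A$ activates each connected component of $(V,A)$ independently with probability $1/q$ (a vertex is active if its component is), removes all edges of $A$ joining two active vertices, and then adds each edge of $G$ joining two active vertices independently with probability $p$, leaving the rest of the configuration unchanged. For either chain, with transition matrix $P$, the mixing time is $\tau_{\rm mix}=\max_{A}\min\{t\ge 0:\|P^t(A,\cdot)-\mu\|_{\rm TV}\le 1/4\}$. **Theorem.** On the complete $n$-vertex graph with $p=\lambda/n$, for all $q>1$ and all $\lambda=O(1)$, the mixing times $\tau_{\rm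 mix}^{\rm GD}$ and $\tau_{\rm mix}^{\rm CM}$ satisfy $$\tau_{\rm mix}^{\rm GD}\le \tau_{\rm mix}^{\rm CM}\cdot O\big(n^3(\log n)^2\big).$$ That is, for every $q>1$ and $\Lambda>0$ there are a constant $C>0$ and an integer $N$, depending only on $q$ and $\Lambda$, such that for all $n\ge N$ and all $\lambda$ with $0<\lambda\le\Lambda$ and $\lambda<n$, $$\tau_{\rm mix}^{\rm GD}\le C\,n^3(\log n)^2\cdot\tau_{\rm mix}^{\rm CM}.$$ -/

import Mathlib

open scoped ENNReal

namespace RandomCluster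

section Mixing

variable {Ω : Type*} [Fintype Ω]

/-- Total variation distance between two (mass functions of) distributions on a finite set. -/
noncomputable def tvDist (μ ν : Ω → ℝ) : ℝ := (1 / 2) * ∑ x, |μ x - ν x|

/-- The `ε`-mixing time `max_x min {t ≥ 0 : ‖P^t(x,·) - π‖_TV ≤ ε}` of the chain with transition
matrix `P` and stationary distribution `π`. The minimum over an empty set of times is `⊤`. -/
noncomputable def mixingTime [DecidableEq Ω] (P : Matrix Ω Ω ℝ) (π : Ω → ℝ) (ε : ℝ) : ℕ∞ :=
  ⨆ x : Ω, ⨅ (t : ℕ) (_ : tvDist ((P ^ t) x) π ≤ ε), (t : ℕ∞)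

end Mixing

section Model

variable {V : Type*} [Fintype V] [DecidableEq V] (G : SimpleGraph V) [DecidableRel G.Adj]

/-- Random-cluster configurations on `G`: all subsets of the edge set. -/
abbrev Config : Type _ := Finset G.edgeSet

variable {G}

/-- The spanning subgraph `(V, A)`. -/
def Config.graph (A : Config G) : SimpleGraph V :=
  SimpleGraph.fromEdgeSet {e | ∃ h : e ∈ G.edgeSet, (⟨e, h⟩ : G.edgeSet) ∈ A}

/-- The number `c(A)` of connected components of `(V, A)`. -/
noncomputable def Config.numComponents (A : Config G) : ℕ :=
  Nat.card A.graph.ConnectedComponent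

variable (G)

/-- The unnormalized weight `p^|A| (1-p)^(|E|-|A|) q^c(A)`. -/
noncomputable def weight (p q : ℝ) (A : Config G) : ℝ :=
  p ^ A.card * (1 - p) ^ (Fintype.card G.edgeSet - A.card) * q ^ A.numComponents

/-- The partition function. -/
noncomputable def partitionFunction (p q : ℝ) : ℝ := ∑ A : Config G, weight G p q A

/-- The random-cluster (Gibbs) measure `μ_{G,p,q}`. -/
noncomputable def gibbs (p q : ℝ) (A : Config G) : ℝ := weight G p q A / partitionFunction G p q

/-- The probability that the heat-bath update of `e` in configuration `A` makes `e` present. -/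
noncomputable def heatBathProb (p q : ℝ) (A : Config G) (e : G.edgeSet) : ℝ :=
  gibbs G p q (insert e A) / (gibbs G p q (insert e A) + gibbs G p q (A.erase e))

/-- The transition matrix of the heat-bath Glauber dynamics: pick an edge `e` uniformly at random,
move to `A ∪ {e}` with the heat-bath probability, else to `A \ {e}`. -/
noncomputable def glauber (p q : ℝ) : Matrix (Config G) (Config G) ℝ := fun A B =>
  ∑ e : G.edgeSet, (1 / (Fintype.card G.edgeSet : ℝ)) *
    ((if B = insert e A then heatBathProb G p q A e else 0) +
      (if B = A.erase e then 1 - heatBathProb G p q A e else 0))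

variable {G} in
open Classical in
/-- The edges of `G` both of whose endpoints are active, when the active components of `(V, A)`
are those in `S`. -/
noncomputable def activeEdges (A : Config G) (S : Finset A.graph.ConnectedComponent) :
    Finset G.edgeSet :=
  Finset.univ.filter fun e => ∀ v ∈ (e : Sym2 V), A.graph.connectedComponentMk v ∈ S

variable {G} in
/-- The probability that the percolation sub-step takes `A` to `B` when `F` is the set of edges of
`G` between active vertices: the edges in `F` are removed, then each edge of `F` is added
independently with probability `p`, and the edges outside `F` are left unchanged. -/
noncomputable def percolationProb (p : ℝ) (F : Finset G.edgeSet) (A B : Config G) : ℝ :=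
  if B \ F = A \ F then p ^ (F ∩ B).card * (1 - p) ^ (F \ B).card else 0

open Classical in
/-- The transition matrix of the Chayes-Machta dynamics: each connected component of `(V, A)` is
activated independently with probability `1 / q` (`S` is the set of activated components), then
the percolation sub-step is performed. -/
noncomputable def chayesMachta (p q : ℝ) : Matrix (Config G) (Config G) ℝ := fun A B =>
  ∑ S : Finset A.graph.ConnectedComponent,
    (1 / q) ^ S.card * (1 - 1 / q) ^ Sᶜ.card * percolationProb p (activeEdges A S) A B

/-- Mixing time of the Glauber dynamics on `G`. -/
noncomputable def mixingTimeGD (p q : ℝ) : ℕ∞ :=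
  mixingTime (glauber G p q) (gibbs G p q) (1 / 4)

/-- Mixing time of the Chayes-Machta dynamics on `G`. -/
noncomputable def mixingTimeCM (p q : ℝ) : ℕ∞ :=
  mixingTime (chayesMachta G p q) (gibbs G p q) (1 / 4)

end Model

end RandomCluster

/-! Write `m` for the number of edges. The spectral gaps are compared through Dirichlet forms.
Couple `A`, drawn from the Gibbs measure, with the random set `U` of active vertices. Given `U`, the
factor `q ^ c(A)` cancels against the activation probabilities up to a term that ignores edges
inside `U`, so those edges are independent with probability `p` (`activation_isCondProb`), and the
percolation sub-step resamples them from their conditional law. By Efron–Stein (`ip_sub_percOp_le`)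
the Chayes–Machta form is at most a sum of single-edge terms with factor `p * (1 - p)`. The
heat-bath variance is at least `p * (1 - p) / q`, so this form is at most `q * m` times the Glauber
form (`chayesMachta_dirichlet_le`).

A chain mixed at time `T` has relaxation time `O(T)` (`poincare_of_tvDist`), hence Glauber has
relaxation time `O(n ^ 2 * τ)`, with `τ` the Chayes–Machta mixing time. The usual passage to mixing
costs `log (1 / μ(A))` for the starting state, which for dense `A` is too large. A burn-in of `n ^
3` steps brings the expected number of edges down to `O(n)` (`glauber_card_le`); for such `A`, `log
(1 / μ(A))` is `O(n log n)` (`exp_neg_le_gibbs`). Markov's inequality joins the two phases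
(`mixingTimeGD_le_add`). The product `n ^ 2 * n log n * τ` lies within the claimed bound. -/

namespace RandomCluster

/-! ### Reversible chains: relaxation time, spectral gap and mixing. -/

section Chains

open Matrix

variable {Ω : Type*} [Fintype Ω]

/-- `P` is a stochastic matrix, reversible with respect to the positive probability vector `π`. -/
structure IsReversible (P : Matrix Ω Ω ℝ) (π : Ω → ℝ) : Prop where
  nonneg : ∀ x y, 0 ≤ P x y
  row_sum : ∀ x, ∑ y, P x y = 1
  pos : ∀ x, 0 < π x
  sum_eq_one : ∑ x, π x = 1
  balance : ∀ x y, π x * P x y = π y * P y x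

/-- The inner product of `L²(π)`. -/
def ip (π f g : Ω → ℝ) : ℝ := ∑ x, π x * (f x * g x)

theorem ip_self_nonneg {π : Ω → ℝ} (hπ : ∀ x, 0 ≤ π x) (f : Ω → ℝ) : 0 ≤ ip π f f :=
  Finset.sum_nonneg fun x _ => mul_nonneg (hπ x) (mul_self_nonneg _)

theorem ip_sq_le {π : Ω → ℝ} (hπ : ∀ x, 0 ≤ π x) (f g : Ω → ℝ) :
    ip π f g ^ 2 ≤ ip π f f * ip π g g := by
  have h := Finset.sum_mul_sq_le_sq_mul_sq Finset.univ
    (fun x => √(π x) * f x) (fun x => √(π x) * g x)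
  have e : ∀ (a b : Ω → ℝ), ∑ x, (√(π x) * a x) * (√(π x) * b x) = ip π a b := fun a b =>
    Finset.sum_congr rfl fun x _ => by
      rw [mul_mul_mul_comm, Real.mul_self_sqrt (hπ x)]
  simp only [sq (√_ * _), e] at h
  exact h

theorem ip_mulVec (P : Matrix Ω Ω ℝ) (π f g : Ω → ℝ) :
    ip π f (P *ᵥ g) = ∑ x, ∑ y, π x * P x y * (f x * g y) := by
  refine Finset.sum_congr rfl fun x _ => ?_
  rw [mulVec, dotProduct, Finset.mul_sum, Finset.mul_sum]
  exact Finset.sum_congr rfl fun y _ => by ring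

/-- Test self-adjointness on indicators. Both dynamics are built from self-adjoint single-edge
updates, so this yields their detailed balance without computing matrix entries. -/
theorem balance_of_ip_comm [DecidableEq Ω] {P : Matrix Ω Ω ℝ} {π : Ω → ℝ}
    (h : ∀ f g, ip π f (P *ᵥ g) = ip π (P *ᵥ f) g) (x y : Ω) : π x * P x y = π y * P y x := by
  have := h (Pi.single x 1) (Pi.single y 1)
  simpa [ip, Pi.single_apply] using this

namespace IsReversible

variable {P Q : Matrix Ω Ω ℝ} {π : Ω → ℝ}

theorem stationary (h : IsReversible P π) (y : Ω) : ∑ x, π x * P x y = π y := by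
  simp_rw [fun x => h.balance x y, ← Finset.mul_sum, h.row_sum, mul_one]

theorem ip_comm (h : IsReversible P π) (f g : Ω → ℝ) : ip π f (P *ᵥ g) = ip π (P *ᵥ f) g := by
  have e : ip π (P *ᵥ f) g = ip π g (P *ᵥ f) := Finset.sum_congr rfl fun x _ => by ring
  rw [e, ip_mulVec, ip_mulVec, Finset.sum_comm]
  refine Finset.sum_congr rfl fun x _ => Finset.sum_congr rfl fun y _ => ?_
  rw [h.balance]; ring

theorem sum_mulVec (h : IsReversible P π) (f : Ω → ℝ) :
    ∑ x, π x * (P *ᵥ f) x = ∑ x, π x * f x := by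
  simp_rw [mulVec, dotProduct, Finset.mul_sum, ← mul_assoc]
  rw [Finset.sum_comm]
  simp_rw [← Finset.sum_mul, h.stationary]

theorem mulVec_mono (h : IsReversible P π) {f g : Ω → ℝ} (hfg : ∀ x, f x ≤ g x) (x : Ω) :
    (P *ᵥ f) x ≤ (P *ᵥ g) x :=
  Finset.sum_le_sum fun y _ => mul_le_mul_of_nonneg_left (hfg y) (h.nonneg x y)

theorem mulVec_const (h : IsReversible P π) (c : ℝ) (x : Ω) : (P *ᵥ fun _ => c) x = c := by
  simp [mulVec, dotProduct, ← Finset.sum_mul, h.row_sum]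

theorem mul (hP : IsReversible P π) (hQ : IsReversible Q π) (hPQ : P * Q = Q * P) :
    IsReversible (P * Q) π where
  nonneg x y := Finset.sum_nonneg fun z _ => mul_nonneg (hP.nonneg _ _) (hQ.nonneg _ _)
  row_sum x := by
    simp_rw [mul_apply]
    rw [Finset.sum_comm]
    simp_rw [← Finset.mul_sum, hQ.row_sum, mul_one, hP.row_sum]
  pos := hP.pos
  sum_eq_one := hP.sum_eq_one
  balance x y := by
    conv_rhs => rw [hPQ]
    simp_rw [mul_apply, Finset.mul_sum]
    refine Finset.sum_congr rfl fun z _ => ?_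
    rw [← mul_assoc, hP.balance, mul_right_comm, hQ.balance]; ring

theorem tvDist_le_one (h : IsReversible P π) (x : Ω) : tvDist (P x) π ≤ 1 := by
  unfold tvDist
  have : ∑ y, |P x y - π y| ≤ ∑ y, (P x y + π y) :=
    Finset.sum_le_sum fun y _ => by
      rw [abs_le]; constructor <;> linarith [h.nonneg x y, h.pos y]
  rw [Finset.sum_add_distrib, h.row_sum, h.sum_eq_one] at this
  linarith

/-- Since `f` has mean zero, `P x y` may be replaced by `P x y - π y`. The kernel `π x * |P x y - π
y|` is symmetric with row sums at most `π x / 2`, so `|f x * f y| ≤ (f x ^ 2 + f y ^ 2) / 2`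
finishes, as in Schur's test. -/
theorem ip_mulVec_le_half (h : IsReversible P π) (hP : ∀ x, tvDist (P x) π ≤ 1 / 4)
    {f : Ω → ℝ} (hf : ∑ x, π x * f x = 0) : ip π f (P *ᵥ f) ≤ 1 / 2 * ip π f f := by
  have row : ∀ x, ∑ y, |P x y - π y| ≤ 1 / 2 := fun x => by
    have := hP x
    unfold tvDist at this
    linarith
  have hsub : ip π f (P *ᵥ f) = ∑ x, ∑ y, π x * (P x y - π y) * (f x * f y) := by
    have : ∑ x, ∑ y, π x * π y * (f x * f y) = 0 := by
      have e : ∑ x, ∑ y, π x * π y * (f x * f y) = (∑ x, π x * f x) * ∑ y, π y * f y := by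
        rw [Finset.sum_mul_sum]
        exact Finset.sum_congr rfl fun x _ => Finset.sum_congr rfl fun y _ => by ring
      rw [e, hf, zero_mul]
    simp_rw [mul_sub, sub_mul, Finset.sum_sub_distrib]
    rw [this, sub_zero, ip_mulVec]
  have hsymm : ∑ x, ∑ y, π x * |P x y - π y| * (f y * f y)
      = ∑ x, ∑ y, π x * |P x y - π y| * (f x * f x) := by
    rw [Finset.sum_comm]
    refine Finset.sum_congr rfl fun x _ => Finset.sum_congr rfl fun y _ => ?_
    congr 1
    rw [← abs_of_pos (h.pos x), ← abs_of_pos (h.pos y), ← abs_mul, ← abs_mul,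
      abs_of_pos (h.pos x), abs_of_pos (h.pos y), mul_sub, mul_sub, h.balance, mul_comm (π x) (π y)]
  have hbound : ∑ x, ∑ y, π x * |P x y - π y| * (f x * f x) ≤ 1 / 2 * ip π f f := by
    rw [ip, Finset.mul_sum]
    refine Finset.sum_le_sum fun x _ => ?_
    rw [← Finset.sum_mul, ← Finset.mul_sum]
    have := mul_le_mul_of_nonneg_left (row x)
      (mul_nonneg (h.pos x).le (mul_self_nonneg (f x)))
    nlinarith
  calc ip π f (P *ᵥ f)
      ≤ ∑ x, ∑ y, (1 / 2 * (π x * |P x y - π y| * (f x * f x))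
          + 1 / 2 * (π x * |P x y - π y| * (f y * f y))) := by
        rw [hsub]
        refine Finset.sum_le_sum fun x _ => Finset.sum_le_sum fun y _ => ?_
        have h1 : (P x y - π y) * (f x * f y) ≤ |P x y - π y| * |f x * f y| := by
          rw [← abs_mul]; exact le_abs_self _
        have h2 : |f x * f y| ≤ 1 / 2 * (f x * f x) + 1 / 2 * (f y * f y) := by
          rw [abs_le]; constructor <;> nlinarith [sq_nonneg (f x - f y), sq_nonneg (f x + f y)]
        have h3 := mul_le_mul_of_nonneg_left
          (h1.trans (mul_le_mul_of_nonneg_left h2 (abs_nonneg _))) (h.pos x).le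
        linarith
    _ ≤ 1 / 2 * ip π f f := by
        simp_rw [Finset.sum_add_distrib, ← Finset.mul_sum]
        rw [hsymm]
        linarith

variable [DecidableEq Ω]

theorem pow (h : IsReversible P π) (t : ℕ) : IsReversible (P ^ t) π := by
  induction t with
  | zero =>
    refine ⟨fun x y => ?_, fun x => ?_, h.pos, h.sum_eq_one, fun x y => ?_⟩
    · rw [pow_zero, one_apply]; split_ifs <;> norm_num
    · simp [one_apply]
    · rw [pow_zero, one_apply, one_apply]
      by_cases e : x = y
      · simp [e]
      · simp [e, Ne.symm e]
  | succ t ih =>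
    rw [pow_succ]
    exact ih.mul h ((Commute.refl P).pow_left t).eq

theorem tvDist_succ_le (h : IsReversible P π) (t : ℕ) (x : Ω) :
    tvDist ((P ^ (t + 1)) x) π ≤ tvDist ((P ^ t) x) π := by
  refine mul_le_mul_of_nonneg_left ?_ (by norm_num)
  calc ∑ y, |(P ^ (t + 1)) x y - π y|
      = ∑ y, |∑ z, ((P ^ t) x z - π z) * P z y| := by
        refine Finset.sum_congr rfl fun y _ => ?_
        simp_rw [sub_mul, Finset.sum_sub_distrib, h.stationary, pow_succ, mul_apply]
    _ ≤ ∑ y, ∑ z, |(P ^ t) x z - π z| * P z y := by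
        refine Finset.sum_le_sum fun y _ => (Finset.abs_sum_le_sum_abs _ _).trans_eq ?_
        simp_rw [abs_mul, fun z => abs_of_nonneg (h.nonneg z y)]
    _ = ∑ z, |(P ^ t) x z - π z| := by
        rw [Finset.sum_comm]
        simp_rw [← Finset.mul_sum, h.row_sum, mul_one]

theorem tvDist_antitone (h : IsReversible P π) (x : Ω) :
    Antitone fun t => tvDist ((P ^ t) x) π :=
  antitone_nat_of_succ_le fun t => h.tvDist_succ_le t x

/-- Since `⟨f, P ^ (2T) f⟩ = ‖P ^ T f‖ ^ 2`, Cauchy–Schwarz squares the bound each time `T` doubles.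
This replaces the spectral theorem and is why times are powers of two. -/
theorem pow_mul_ip_le (h : IsReversible P π) {f : Ω → ℝ} {θ : ℝ} (hθ : 0 ≤ θ)
    (hf : θ * ip π f f ≤ ip π f (P *ᵥ f)) (a : ℕ) :
    θ ^ 2 ^ a * ip π f f ≤ ip π f (P ^ 2 ^ a *ᵥ f) := by
  have hb := ip_self_nonneg (fun x => (h.pos x).le) f
  rcases hb.eq_or_lt with hb0 | hb0
  · rw [← hb0, mul_zero]
    have := ip_sq_le (fun x => (h.pos x).le) f (P ^ 2 ^ a *ᵥ f)
    rw [← hb0, zero_mul] at this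
    rw [pow_eq_zero_iff two_ne_zero |>.1 (le_antisymm this (sq_nonneg _))]
  · induction a with
    | zero => simpa using hf
    | succ a ih =>
      have h1 := ip_sq_le (fun x => (h.pos x).le) f (P ^ 2 ^ a *ᵥ f)
      have h2 : ip π f (P ^ 2 ^ (a + 1) *ᵥ f) = ip π (P ^ 2 ^ a *ᵥ f) (P ^ 2 ^ a *ᵥ f) := by
        rw [← (h.pow _).ip_comm, mulVec_mulVec, ← pow_add]
        congr 3; ring
      rw [h2]
      have h3 := pow_le_pow_left₀ (mul_nonneg (pow_nonneg hθ _) hb) ih 2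
      have h4 : ip π f f * (θ ^ 2 ^ (a + 1) * ip π f f) = (θ ^ 2 ^ a * ip π f f) ^ 2 := by
        rw [pow_succ 2 a, pow_mul]; ring
      exact le_of_mul_le_mul_left (h4 ▸ h3.trans h1) hb0

/-- A reversible chain that is mixed at time `T = 2 ^ a` has relaxation time at most `2 T`. -/
theorem poincare_of_tvDist (h : IsReversible P π) (a : ℕ)
    (hP : ∀ x, tvDist ((P ^ 2 ^ a) x) π ≤ 1 / 4) {f : Ω → ℝ} (hf : ∑ x, π x * f x = 0) :
    ip π f f ≤ 2 * (2 : ℝ) ^ a * (ip π f f - ip π f (P *ᵥ f)) := by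
  have hT : (1 : ℝ) ≤ 2 ^ a := one_le_pow₀ one_le_two
  have hb := ip_self_nonneg (fun x => (h.pos x).le) f
  -- Chosen so that Bernoulli's inequality gives `θ ^ T ≥ 1 / 2` with `T = 2 ^ a`; a Rayleigh
  -- quotient above `θ` would then contradict `ip_mulVec_le_half` at time `T`.
  set θ : ℝ := 1 - 1 / (2 * 2 ^ a) with hθ
  have hθ0 : 0 < θ := by
    have : 1 / (2 * (2 : ℝ) ^ a) ≤ 1 / 2 := by
      apply one_div_le_one_div_of_le <;> linarith
    linarith
  have hbern : 1 / 2 ≤ θ ^ 2 ^ a := by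
    have := one_add_mul_le_pow (a := -(1 / (2 * (2 : ℝ) ^ a))) (by linarith) (2 ^ a)
    refine le_trans (le_of_eq ?_) (this.trans_eq (by rw [hθ, sub_eq_add_neg]))
    push_cast
    field_simp
    norm_num
  suffices hle : ip π f (P *ᵥ f) ≤ θ * ip π f f by
    have : ip π f f / (2 * 2 ^ a) ≤ ip π f f - ip π f (P *ᵥ f) := by
      have : ip π f f / (2 * 2 ^ a) = ip π f f - θ * ip π f f := by rw [hθ]; ring
      linarith
    rw [div_le_iff₀ (by positivity)] at this
    linarith
  by_contra! hlt
  rcases hb.eq_or_lt with hb0 | hb0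
  · have := ip_sq_le (fun x => (h.pos x).le) f (P *ᵥ f)
    rw [← hb0, zero_mul] at this
    rw [← hb0, mul_zero, pow_eq_zero_iff two_ne_zero |>.1 (le_antisymm this (sq_nonneg _))] at hlt
    exact lt_irrefl _ hlt
  · obtain ⟨η, hη, hηle⟩ : ∃ η, θ < η ∧ η * ip π f f ≤ ip π f (P *ᵥ f) :=
      ⟨ip π f (P *ᵥ f) / ip π f f, by rwa [lt_div_iff₀ hb0], by rw [div_mul_cancel₀ _ hb0.ne']⟩
    have h1 := h.pow_mul_ip_le (hθ0.trans hη).le hηle a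
    have h2 := (h.pow (2 ^ a)).ip_mulVec_le_half hP hf
    have h3 : θ ^ 2 ^ a < η ^ 2 ^ a := pow_lt_pow_left₀ hη hθ0.le (by positivity)
    have h4 : η ^ 2 ^ a ≤ 1 / 2 := le_of_mul_le_mul_right (h1.trans h2) hb0
    linarith

/-- The hypothesis `hpos` says `P ^ 2 ≤ P` as quadratic forms, so negative eigenvalues play no role
and the gap alone contracts the squared norm. -/
theorem ip_pow_le (h : IsReversible P π) {K : ℝ} (hK : 1 ≤ K)
    (hpos : ∀ f, ip π (P *ᵥ f) (P *ᵥ f) ≤ ip π f (P *ᵥ f))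
    (hgap : ∀ f, ∑ x, π x * f x = 0 → ip π f f ≤ K * (ip π f f - ip π f (P *ᵥ f)))
    {f : Ω → ℝ} (hf : ∑ x, π x * f x = 0) (s : ℕ) :
    ip π (P ^ s *ᵥ f) (P ^ s *ᵥ f) ≤ (1 - 1 / K) ^ s * ip π f f := by
  have hK0 : 0 < K := by linarith
  induction s with
  | zero => simp
  | succ s ih =>
    have h0 : ∑ x, π x * (P ^ s *ᵥ f) x = 0 := by rw [(h.pow s).sum_mulVec, hf]
    have h1 := hgap _ h0
    have h2 := hpos (P ^ s *ᵥ f)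
    rw [mulVec_mulVec, ← pow_succ'] at h2
    rw [mulVec_mulVec, ← pow_succ'] at h1
    rw [← div_le_iff₀' hK0] at h1
    have h3 : (0 : ℝ) ≤ 1 - 1 / K := by
      rw [sub_nonneg, div_le_one hK0]; exact hK
    have h4 := mul_le_mul_of_nonneg_left ih h3
    rw [pow_succ' (1 - 1 / K)]
    calc ip π (P ^ (s + 1) *ᵥ f) (P ^ (s + 1) *ᵥ f) ≤ _ := h2
      _ ≤ (1 - 1 / K) * ip π (P ^ s *ᵥ f) (P ^ s *ᵥ f) := by
        rw [sub_mul, one_mul, one_div_mul_eq_div]; linarith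
      _ ≤ _ := by linarith

/-- Convergence in total variation from a spectral gap, for a positive semidefinite chain. -/
theorem tvDist_pow_le (h : IsReversible P π) {K : ℝ} (hK : 1 ≤ K)
    (hpos : ∀ f, ip π (P *ᵥ f) (P *ᵥ f) ≤ ip π f (P *ᵥ f))
    (hgap : ∀ f, ∑ x, π x * f x = 0 → ip π f f ≤ K * (ip π f f - ip π f (P *ᵥ f)))
    (s : ℕ) (x : Ω) {b : ℝ} (hb : 0 ≤ b) (hs : (1 - 1 / K) ^ s ≤ 4 * b ^ 2 * π x) :
    tvDist ((P ^ s) x) π ≤ b := by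
  -- The centred density of the point mass at `x`; by reversibility `π * P ^ s f` is `P ^ s (x, ·) -
  -- π`.
  set f : Ω → ℝ := fun y => Pi.single (M := fun _ => ℝ) x (1 / π x) y - 1 with hfdef
  have hx := h.pos x
  have hsingle : ∑ y, π y * Pi.single (M := fun _ => ℝ) x (1 / π x) y = 1 := by
    simp [Pi.single_apply, hx.ne']
  have hf : ∑ y, π y * f y = 0 := by
    simp_rw [hfdef, mul_sub, Finset.sum_sub_distrib, mul_one, h.sum_eq_one, hsingle, sub_self]
  have hff : ip π f f ≤ 1 / π x := by
    have e : ip π f f = ∑ y, (π y * (Pi.single (M := fun _ => ℝ) x (1 / π x) y) ^ 2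
        - 2 * (π y * Pi.single (M := fun _ => ℝ) x (1 / π x) y) + π y) :=
      Finset.sum_congr rfl fun y _ => by rw [hfdef]; ring
    rw [e, Finset.sum_add_distrib, Finset.sum_sub_distrib, ← Finset.mul_sum, hsingle, h.sum_eq_one]
    have : ∑ y, π y * (Pi.single (M := fun _ => ℝ) x (1 / π x) y) ^ 2 = 1 / π x := by
      simp only [Pi.single_apply, ite_pow, mul_ite]
      simp
      field_simp
    rw [this]; linarith
  have hPf : ∀ y, π y * (P ^ s *ᵥ f) y = (P ^ s) x y - π y := fun y => by
    have : (P ^ s *ᵥ f) y = (P ^ s) y x / π x - 1 := by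
      simp_rw [hfdef, mulVec, dotProduct, mul_sub, Finset.sum_sub_distrib, mul_one,
        (h.pow s).row_sum]
      simp [Pi.single_apply, div_eq_mul_inv]
    rw [this, mul_sub, mul_div_assoc', (h.pow s).balance, mul_div_cancel_left₀ _ hx.ne', mul_one]
  have hsq : (∑ y, |(P ^ s) x y - π y|) ^ 2 ≤ ip π (P ^ s *ᵥ f) (P ^ s *ᵥ f) := by
    have h1 := ip_sq_le (fun x => (h.pos x).le) (fun y => |(P ^ s *ᵥ f) y|) (fun _ => 1)
    have h2 : ip π (fun y => |(P ^ s *ᵥ f) y|) (fun _ => 1) = ∑ y, |(P ^ s) x y - π y| :=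
      Finset.sum_congr rfl fun y _ => by
        rw [← hPf, abs_mul, abs_of_pos (h.pos y), mul_one]
    have h3 : ip π (fun _ => 1) (fun _ => 1) = 1 := by simp [ip, h.sum_eq_one]
    have h4 : ip π (fun y => |(P ^ s *ᵥ f) y|) (fun y => |(P ^ s *ᵥ f) y|)
        = ip π (P ^ s *ᵥ f) (P ^ s *ᵥ f) :=
      Finset.sum_congr rfl fun y _ => by rw [abs_mul_abs_self]
    rwa [h2, h3, h4, mul_one] at h1
  have hfin : (∑ y, |(P ^ s) x y - π y|) ^ 2 ≤ (2 * b) ^ 2 := by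
    have h1 := h.ip_pow_le hK hpos hgap hf s
    have h0 : (0 : ℝ) ≤ (1 - 1 / K) ^ s := by
      apply pow_nonneg; rw [sub_nonneg, div_le_one (by linarith)]; exact hK
    have h2 := mul_le_mul_of_nonneg_left hff h0
    have h3 : (1 - 1 / K) ^ s * (1 / π x) ≤ (2 * b) ^ 2 := by
      rw [mul_one_div, div_le_iff₀ hx]; linarith
    linarith
  have := abs_le_of_sq_le_sq hfin (by positivity)
  unfold tvDist
  linarith [(le_abs_self _).trans this]

/-- Running the chain for `t` steps before measuring the distance to stationarity. -/
theorem tvDist_pow_add_le (h : IsReversible P π) (t s : ℕ) (x : Ω) :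
    tvDist ((P ^ (t + s)) x) π ≤ (P ^ t *ᵥ fun y => tvDist ((P ^ s) y) π) x := by
  have e : (P ^ t *ᵥ fun y => tvDist ((P ^ s) y) π) x
      = 1 / 2 * ∑ z, ∑ y, (P ^ t) x y * |(P ^ s) y z - π z| := by
    unfold tvDist
    rw [Finset.sum_comm, mulVec, dotProduct, Finset.mul_sum]
    refine Finset.sum_congr rfl fun y _ => ?_
    rw [← Finset.mul_sum]; ring
  rw [e, tvDist]
  gcongr with z
  have : (P ^ (t + s)) x z - π z = ∑ y, (P ^ t) x y * ((P ^ s) y z - π z) := by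
    simp_rw [mul_sub, Finset.sum_sub_distrib, ← Finset.sum_mul, (h.pow t).row_sum, one_mul,
      pow_add, mul_apply]
  rw [this]
  refine (Finset.abs_sum_le_sum_abs _ _).trans_eq (Finset.sum_congr rfl fun y _ => ?_)
  rw [abs_mul, abs_of_nonneg ((h.pow t).nonneg x y)]

/-- Iterating a one-step drift inequality. -/
theorem pow_mulVec_le_of_drift (h : IsReversible P π) {N : Ω → ℝ} {a c : ℝ} (ha : 0 ≤ a)
    (hN : ∀ x, (P *ᵥ N) x ≤ a * N x + (1 - a) * c) (t : ℕ) (x : Ω) :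
    (P ^ t *ᵥ N) x ≤ a ^ t * N x + (1 - a ^ t) * c := by
  induction t generalizing x with
  | zero => simp
  | succ t ih =>
    rw [pow_succ', ← mulVec_mulVec]
    refine (h.mulVec_mono ih x).trans ?_
    have e : (P *ᵥ fun y => a ^ t * N y + (1 - a ^ t) * c) x
        = a ^ t * (P *ᵥ N) x + (1 - a ^ t) * c := by
      have h1 : (fun y => a ^ t * N y + (1 - a ^ t) * c)
          = a ^ t • N + fun _ => (1 - a ^ t) * c := rfl
      rw [h1, mulVec_add, mulVec_smul, Pi.add_apply, h.mulVec_const]; rfl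
    rw [e]
    have := mul_le_mul_of_nonneg_left (hN x) (pow_nonneg ha t)
    rw [pow_succ]
    linarith

/-- A point mass within `1 / 4` of `π` forces `π x ≥ 3 / 4`, impossible at two points. Needed
because the burn-in time is absorbed using `τ ≥ 1`. -/
theorem mixingTime_ne_zero (h : IsReversible P π) [Nontrivial Ω] : mixingTime P π (1 / 4) ≠ 0 := by
  intro h0
  have key : ∀ x, 3 / 4 ≤ π x := fun x => by
    have h1 : (⨅ (t : ℕ) (_ : tvDist ((P ^ t) x) π ≤ 1 / 4), (t : ℕ∞)) < 1 := by
      refine lt_of_le_of_lt ((le_iSup (fun x => ⨅ (t : ℕ)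
        (_ : tvDist ((P ^ t) x) π ≤ 1 / 4), (t : ℕ∞)) x).trans h0.le) zero_lt_one
    simp only [iInf_lt_iff] at h1
    obtain ⟨t, ht, ht1⟩ := h1
    obtain rfl : t = 0 := by simpa using ht1
    unfold tvDist at ht
    have h2 : ∑ y, |((P ^ 0) x) y - π y| = 2 * (1 - π x) := by
      have h3 : ∀ y, |((P ^ 0) x) y - π y| = π y + (1 - 2 * π x) * Pi.single (M := fun _ => ℝ) x 1 y := by
        intro y
        have hy1 : π x ≤ 1 := h.sum_eq_one ▸
          Finset.single_le_sum (fun z _ => (h.pos z).le) (Finset.mem_univ x)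
        rcases eq_or_ne x y with rfl | hne
        · simp [abs_of_nonneg (sub_nonneg.2 hy1)]; ring
        · simp [one_apply_ne hne, hne.symm, abs_of_pos (h.pos y)]
      simp_rw [h3, Finset.sum_add_distrib, ← Finset.mul_sum, h.sum_eq_one]
      simp; ring
    rw [h2] at ht
    linarith
  obtain ⟨x, y, hxy⟩ := exists_pair_ne Ω
  have h1 : π x + π y ≤ 1 := by
    rw [← h.sum_eq_one, ← Finset.sum_pair hxy]
    exact Finset.sum_le_sum_of_subset_of_nonneg (Finset.subset_univ _) fun z _ _ => (h.pos z).le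
  linarith [key x, key y]

theorem tvDist_le_of_mixingTime_le (h : IsReversible P π) {ε : ℝ} {k : ℕ}
    (hk : mixingTime P π ε ≤ k) (x : Ω) : tvDist ((P ^ k) x) π ≤ ε := by
  -- A strict bound by `k + 1` extracts an actual mixed time `t ≤ k` from the infimum.
  have h1 : (⨅ (t : ℕ) (_ : tvDist ((P ^ t) x) π ≤ ε), (t : ℕ∞)) < ((k + 1 : ℕ) : ℕ∞) := by
    refine lt_of_le_of_lt ((le_iSup (fun x => ⨅ (t : ℕ)
      (_ : tvDist ((P ^ t) x) π ≤ ε), (t : ℕ∞)) x).trans hk) ?_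
    exact_mod_cast Nat.lt_succ_self k
  simp only [iInf_lt_iff] at h1
  obtain ⟨t, ht, htk⟩ := h1
  have : t ≤ k := Nat.lt_succ_iff.1 (by exact_mod_cast htk)
  exact (h.tvDist_antitone x this).trans ht

end IsReversible

theorem mixingTime_le [DecidableEq Ω] {P : Matrix Ω Ω ℝ} {π : Ω → ℝ} {ε : ℝ} {t : ℕ}
    (h : ∀ x, tvDist ((P ^ t) x) π ≤ ε) : mixingTime P π ε ≤ t :=
  iSup_le fun x => iInf₂_le t (h x)

end Chains

/-! ### Single-coordinate resampling as a projection. -/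

section Updates

variable {α : Type*} [DecidableEq α]

/-- Resampling the coordinate `e`, which is present with probability `h A`. -/
def upd (e : α) (h f : Finset α → ℝ) (A : Finset α) : ℝ :=
  h A * f (insert e A) + (1 - h A) * f (A.erase e)

/-- The discrete gradient in the coordinate `e`. -/
def grad (e : α) (f : Finset α → ℝ) (A : Finset α) : ℝ := f (insert e A) - f (A.erase e)

/-- `h` is the conditional probability, under the weight `r`, that `e` is present given the
other coordinates. -/
structure IsCondProb (e : α) (r h : Finset α → ℝ) : Prop where
  insert_eq : ∀ A, h (insert e A) = h A
  erase_eq : ∀ A, h (A.erase e) = h A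
  ratio : ∀ A, (1 - h A) * r (insert e A) = h A * r (A.erase e)

theorem insert_erase' (e : α) (A : Finset α) : insert e (A.erase e) = insert e A := by
  ext x; simp; tauto

theorem upd_insert {e : α} {r h : Finset α → ℝ} (H : IsCondProb e r h) (f : Finset α → ℝ)
    (A : Finset α) : upd e h f (insert e A) = upd e h f A := by
  simp [upd, H.insert_eq]

theorem upd_erase {e : α} {r h : Finset α → ℝ} (H : IsCondProb e r h) (f : Finset α → ℝ)
    (A : Finset α) : upd e h f (A.erase e) = upd e h f A := by
  simp [upd, H.erase_eq, insert_erase']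

theorem insert_erase_of_ne {a b : α} (hab : a ≠ b) (A : Finset α) :
    insert a (A.erase b) = (insert a A).erase b := by
  ext x; simp; grind

theorem upd_comm {a b : α} (hab : a ≠ b) (p : ℝ) (f : Finset α → ℝ) :
    upd a (fun _ => p) (upd b (fun _ => p) f) = upd b (fun _ => p) (upd a (fun _ => p) f) := by
  funext A
  simp only [upd]
  rw [Finset.insert_comm b a, Finset.erase_right_comm (a := a) (b := b),
    insert_erase_of_ne hab.symm, insert_erase_of_ne hab]
  ring

theorem grad_upd {a b : α} (hab : a ≠ b) (p : ℝ) (f : Finset α → ℝ) :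
    grad b (upd a (fun _ => p) f) = upd a (fun _ => p) (grad b f) := by
  funext A
  simp only [upd, grad]
  rw [Finset.insert_comm b a, Finset.erase_right_comm (a := a) (b := b),
    insert_erase_of_ne hab.symm, insert_erase_of_ne hab]
  ring

variable [Fintype α]

/-- Toggling `e` is an involution. An identity summed over all sets thus reduces to the pairs
`insert e A`, `A.erase e`. -/
theorem two_mul_sum_eq (e : α) (ψ : Finset α → ℝ) :
    2 * ∑ A, ψ A = ∑ A, (ψ (insert e A) + ψ (A.erase e)) := by
  have hinv : Function.Involutive fun A : Finset α => symmDiff A {e} := fun A =>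
    symmDiff_symmDiff_cancel_right _ _
  have h1 : ∑ A, ψ (symmDiff A {e}) = ∑ A, ψ A := Equiv.sum_comp hinv.toPerm ψ
  rw [two_mul]
  nth_rw 2 [← h1]
  rw [← Finset.sum_add_distrib]
  refine Finset.sum_congr rfl fun A _ => ?_
  by_cases he : e ∈ A
  · have : symmDiff A {e} = A.erase e := by
      ext x; simp [Finset.mem_symmDiff]; grind
    rw [this, Finset.insert_eq_of_mem he]
  · have : symmDiff A {e} = insert e A := by
      ext x; simp [Finset.mem_symmDiff]; grind
    rw [this, Finset.erase_eq_of_notMem he, add_comm]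

section Weighted

variable {e : α} {r h : Finset α → ℝ}

theorem sum_upd (H : IsCondProb e r h) (φ : Finset α → ℝ) : ∑ A, r A * upd e h φ A = ∑ A, r A * φ A := by
  rw [← sub_eq_zero, ← Finset.sum_sub_distrib]
  have h2 := two_mul_sum_eq e fun A => r A * upd e h φ A - r A * φ A
  have h3 : ∀ A, r (insert e A) * upd e h φ (insert e A) - r (insert e A) * φ (insert e A)
      + (r (A.erase e) * upd e h φ (A.erase e) - r (A.erase e) * φ (A.erase e)) = 0 := fun A => by
    rw [upd_insert H, upd_erase H, upd]
    linear_combination (φ (A.erase e) - φ (insert e A)) * H.ratio A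
  simp only [h3, Finset.sum_const_zero] at h2
  linarith

/-- `upd` is the conditional expectation given the coordinates other than `e`; the left side is the
averaged conditional covariance, which for a Bernoulli coordinate is `h * (1 - h)` times the
gradients. -/
theorem ip_sub_upd (H : IsCondProb e r h) (f g : Finset α → ℝ) :
    ip r f g - ip r f (upd e h g)
      = ∑ A, r A * (h A * (1 - h A) * (grad e f A * grad e g A)) := by
  rw [ip, ip, ← Finset.sum_sub_distrib]
  have h1 := sum_upd H fun A => f A * (g A - upd e h g A)
  calc _ = ∑ A, r A * (f A * (g A - upd e h g A)) := Finset.sum_congr rfl fun A _ => by ring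
    _ = _ := h1.symm
    _ = _ := Finset.sum_congr rfl fun A _ => by
      congr 1
      rw [upd, upd_insert H, upd_erase H, upd, grad, grad]; ring

theorem ip_upd_comm (H : IsCondProb e r h) (f g : Finset α → ℝ) : ip r f (upd e h g) = ip r (upd e h f) g := by
  have h1 := ip_sub_upd H f g
  have h2 := ip_sub_upd H g f
  have h3 : ∀ a b, ip r a b = ip r b a := fun a b =>
    Finset.sum_congr rfl fun A _ => by rw [mul_comm (a A)]
  rw [h3 g f, h3 g] at h2
  simp_rw [mul_comm (grad e g _)] at h2
  linarith

theorem ip_upd_upd (H : IsCondProb e r h) (f : Finset α → ℝ) :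
    ip r (upd e h f) (upd e h f) = ip r f (upd e h f) := by
  rw [ip, ip, ← sum_upd H fun A => f A * upd e h f A]
  refine Finset.sum_congr rfl fun A _ => ?_
  congr 1
  conv_rhs => rw [upd, upd_insert H, upd_erase H]
  nth_rw 1 [upd]
  ring

end Weighted

end Updates

/-! ### The percolation sub-step as a product of commuting edge updates. -/

section Percolation

variable {V : Type*} [DecidableEq V] {G : SimpleGraph V}

theorem percolationProb_nonneg {p : ℝ} (hp : 0 ≤ p) (hp1 : p ≤ 1) (F : Finset G.edgeSet)
    (A B : Config G) : 0 ≤ percolationProb p F A B := by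
  have := sub_nonneg.2 hp1
  unfold percolationProb
  split_ifs <;> positivity

theorem percolationProb_insert {p : ℝ} {e : G.edgeSet} {F : Finset G.edgeSet} (he : e ∉ F)
    (A B : Config G) : percolationProb p (insert e F) A B
      = p * percolationProb p F (insert e A) B
        + (1 - p) * percolationProb p F (A.erase e) B := by
  unfold percolationProb
  by_cases hB : e ∈ B
  · have h1 : ¬ B \ F = A.erase e \ F := fun h => by
      have : e ∈ B \ F := by simp [hB, he]
      rw [h] at this; simp at this
    have h2 : B \ insert e F = A \ insert e F ↔ B \ F = insert e A \ F := by
      simp only [Finset.ext_iff, Finset.mem_sdiff, Finset.mem_insert]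
      grind
    have h3 : insert e F ∩ B = insert e (F ∩ B) := Finset.insert_inter_of_mem hB
    have h4 : insert e F \ B = F \ B := Finset.insert_sdiff_of_mem _ hB
    rw [if_neg h1, mul_zero, add_zero, h3, h4, Finset.card_insert_of_notMem (by simp [he])]
    simp only [h2]
    split_ifs
    · ring
    · simp
  · have h1 : ¬ B \ F = insert e A \ F := fun h => by
      have : e ∈ insert e A \ F := by simp [he]
      rw [← h] at this; simp [hB] at this
    have h2 : B \ insert e F = A \ insert e F ↔ B \ F = A.erase e \ F := by
      simp only [Finset.ext_iff, Finset.mem_sdiff, Finset.mem_insert, Finset.mem_erase]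
      grind
    have h3 : insert e F ∩ B = F ∩ B := Finset.insert_inter_of_notMem hB
    have h4 : insert e F \ B = insert e (F \ B) := Finset.insert_sdiff_of_notMem _ hB
    rw [if_neg h1, mul_zero, zero_add, h3, h4, Finset.card_insert_of_notMem (by simp [he])]
    simp only [h2]
    split_ifs
    · ring
    · simp

variable [Fintype V] [DecidableRel G.Adj]

/-- The Markov operator of the percolation sub-step on the edges in `F`. -/
noncomputable def percOp (p : ℝ) (F : Finset G.edgeSet) (f : Config G → ℝ) (A : Config G) : ℝ :=
  ∑ B, percolationProb p F A B * f B

theorem percOp_empty (p : ℝ) (f : Config G → ℝ) : percOp p ∅ f = f := by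
  funext A
  simp [percOp, percolationProb]

theorem percOp_insert {p : ℝ} {e : G.edgeSet} {F : Finset G.edgeSet} (he : e ∉ F)
    (f : Config G → ℝ) : percOp p (insert e F) f = upd e (fun _ => p) (percOp p F f) := by
  funext A
  simp only [percOp, upd, percolationProb_insert he, add_mul, Finset.sum_add_distrib,
    Finset.mul_sum, mul_assoc]

theorem sum_percolationProb (p : ℝ) (F : Finset G.edgeSet) (A : Config G) :
    ∑ B, percolationProb p F A B = 1 := by
  suffices h : percOp p F (fun _ => 1) = fun _ => 1 by
    simpa [percOp] using congrFun h A
  induction F using Finset.induction_on with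
  | empty => rw [percOp_empty]
  | insert e F he ih => rw [percOp_insert he, ih]; funext A; simp [upd]

theorem upd_percOp {p : ℝ} {e : G.edgeSet} {F : Finset G.edgeSet} (he : e ∉ F)
    (f : Config G → ℝ) :
    upd e (fun _ => p) (percOp p F f) = percOp p F (upd e (fun _ => p) f) := by
  induction F using Finset.induction_on with
  | empty => simp only [percOp_empty]
  | insert a F ha ih =>
    rw [percOp_insert ha, percOp_insert ha, upd_comm (fun h => he (by simp [h])),
      ih (fun h => he (by simp [h]))]

theorem grad_percOp {p : ℝ} {e : G.edgeSet} {F : Finset G.edgeSet} (he : e ∉ F)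
    (f : Config G → ℝ) : grad e (percOp p F f) = percOp p F (grad e f) := by
  induction F using Finset.induction_on with
  | empty => simp only [percOp_empty]
  | insert a F ha ih =>
    rw [percOp_insert ha, percOp_insert ha, grad_upd (fun h => he (by simp [h])),
      ih (fun h => he (by simp [h]))]

section Weighted

variable {p : ℝ} {r : Config G → ℝ} {F : Finset G.edgeSet}

theorem ip_percOp_comm (H : ∀ e ∈ F, IsCondProb e r fun _ => p) (f g : Config G → ℝ) :
    ip r f (percOp p F g) = ip r (percOp p F f) g := by
  induction F using Finset.induction_on generalizing f g with
  | empty => simp only [percOp_empty]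
  | insert e F he ih =>
    rw [percOp_insert he, percOp_insert he, ip_upd_comm (H e (Finset.mem_insert_self _ _)),
      ih (fun a ha => H a (Finset.mem_insert_of_mem ha)), upd_percOp he]

theorem ip_percOp_self_le (hp : 0 ≤ p) (hp1 : p ≤ 1) (hr : ∀ A, 0 ≤ r A)
    (H : ∀ e ∈ F, IsCondProb e r fun _ => p) (f : Config G → ℝ) :
    ip r (percOp p F f) (percOp p F f) ≤ ip r f f := by
  induction F using Finset.induction_on with
  | empty => simp only [percOp_empty, le_refl]
  | insert e F he ih =>
    have He := H e (Finset.mem_insert_self _ _)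
    refine le_trans ?_ (ih fun a ha => H a (Finset.mem_insert_of_mem ha))
    rw [percOp_insert he, ip_upd_upd He, ← sub_nonneg, ip_sub_upd He]
    exact Finset.sum_nonneg fun A _ => mul_nonneg (hr A)
      (mul_nonneg (mul_nonneg hp (sub_nonneg.2 hp1)) (mul_self_nonneg _))

/-- The Efron-Stein inequality for the percolation sub-step. -/
theorem ip_sub_percOp_le (hp : 0 ≤ p) (hp1 : p ≤ 1) (hr : ∀ A, 0 ≤ r A)
    (H : ∀ e ∈ F, IsCondProb e r fun _ => p) (f : Config G → ℝ) :
    ip r f f - ip r f (percOp p F f)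
      ≤ ∑ e ∈ F, ∑ A, r A * (p * (1 - p) * (grad e f A * grad e f A)) := by
  induction F using Finset.induction_on with
  | empty => simp [percOp_empty]
  | insert e F he ih =>
    have He := H e (Finset.mem_insert_self _ _)
    have HF := fun a ha => H a (Finset.mem_insert_of_mem ha)
    rw [Finset.sum_insert he, percOp_insert he]
    -- Telescoping: adding `e` to `F` changes `⟨f, percOp f⟩` by `p * (1 - p) * ⟨grad f, percOp
    -- (grad f)⟩`, and `percOp` is a contraction.
    have h1 := ip_sub_upd He f (percOp p F f)
    rw [grad_percOp he] at h1
    have h2 : ∀ g k : Config G → ℝ, ∑ A, r A * (p * (1 - p) * (g A * k A))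
        = p * (1 - p) * ip r g k := fun g k => by
      rw [ip, Finset.mul_sum]; exact Finset.sum_congr rfl fun A _ => by ring
    have h3 : ip r (grad e f) (percOp p F (grad e f)) ≤ ip r (grad e f) (grad e f) := by
      refine le_of_sq_le_sq ?_ (ip_self_nonneg hr _)
      refine (ip_sq_le hr _ _).trans ?_
      rw [sq]
      exact mul_le_mul_of_nonneg_left (ip_percOp_self_le hp hp1 hr HF _) (ip_self_nonneg hr _)
    rw [h2] at h1 ⊢
    have h4 := mul_le_mul_of_nonneg_left h3 (mul_nonneg hp (sub_nonneg.2 hp1))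
    linarith [ih HF]

end Weighted

end Percolation

/-! ### Connected components under addition of one edge. -/

section Components

variable {V : Type*}

theorem reachable_of_adj_or {H H' : SimpleGraph V} {u v : V}
    (h : ∀ x y, H'.Adj x y → H.Adj x y ∨ s(x, y) = s(u, v)) {x y : V} (w : H'.Walk x y) :
    H.Reachable x y ∨
      ((H.Reachable u x ∨ H.Reachable v x) ∧ (H.Reachable u y ∨ H.Reachable v y)) := by
  induction w with
  | nil => exact Or.inl (SimpleGraph.Reachable.refl _)
  | @cons x z y hadj w ih =>
    rcases h _ _ hadj with h1 | h1
    · rcases ih with h2 | ⟨h2, h3⟩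
      · exact Or.inl (h1.reachable.trans h2)
      · exact Or.inr ⟨h2.imp (·.trans h1.symm.reachable) (·.trans h1.symm.reachable), h3⟩
    · right
      rcases Sym2.eq_iff.1 h1 with ⟨rfl, rfl⟩ | ⟨rfl, rfl⟩
      · exact ⟨Or.inl (SimpleGraph.Reachable.refl _), ih.elim Or.inr And.right⟩
      · exact ⟨Or.inr (SimpleGraph.Reachable.refl _), ih.elim Or.inl And.right⟩

theorem card_connectedComponent_anti [Finite V] {H H' : SimpleGraph V} (hle : H ≤ H') :
    Nat.card H'.ConnectedComponent ≤ Nat.card H.ConnectedComponent :=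
  Nat.card_le_card_of_surjective _ (SimpleGraph.ConnectedComponent.surjective_map_ofLE hle)

/-- Set aside the component of `u`: the other components of `H` stay distinct in `H'`, since two
that merge would both have to contain `v`. -/
theorem card_connectedComponent_le_add_one [Finite V] {H H' : SimpleGraph V} (hle : H ≤ H')
    {u v : V} (h : ∀ x y, H'.Adj x y → H.Adj x y ∨ s(x, y) = s(u, v)) :
    Nat.card H.ConnectedComponent ≤ Nat.card H'.ConnectedComponent + 1 := by
  classical
  rw [← Finite.card_option]
  refine Nat.card_le_card_of_injective (fun c => if c = H.connectedComponentMk u then none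
    else some (c.map (SimpleGraph.Hom.ofLE hle))) fun c d hcd => ?_
  induction c using SimpleGraph.ConnectedComponent.ind with | h x
  induction d using SimpleGraph.ConnectedComponent.ind with | h y
  dsimp only at hcd
  split_ifs at hcd with h1 h2 h2
  · rw [h1, h2]
  · rw [Option.some_inj, SimpleGraph.ConnectedComponent.map_mk,
      SimpleGraph.ConnectedComponent.map_mk, SimpleGraph.ConnectedComponent.eq] at hcd
    obtain ⟨w⟩ := hcd
    rw [SimpleGraph.ConnectedComponent.eq] at h1 h2 ⊢
    rcases reachable_of_adj_or h w with h3 | ⟨h3, h4⟩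
    · exact h3
    · exact (h3.resolve_left fun h5 => h1 h5.symm).symm.trans
        (h4.resolve_left fun h5 => h2 h5.symm)

/-- Choose one representative in `s` for each value of `f`; `g` is injective on representatives. -/
theorem card_image_le_card_image {ι β γ : Type*} [DecidableEq β] [DecidableEq γ]
    {s : Finset ι} {f : ι → β} {g : ι → γ} (h : ∀ x ∈ s, ∀ y ∈ s, g x = g y → f x = f y) :
    (s.image f).card ≤ (s.image g).card := by
  obtain ⟨u, hus, huf, himg⟩ := Finset.exists_subset_injOn_image_eq_of_surjOn (f := f) s
    (s.image f) (by intro y hy; simpa using hy)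
  have hug : Set.InjOn g u := fun x hx y hy hxy => huf hx hy (h x (hus hx) y (hus hy) hxy)
  rw [← himg, Finset.card_image_of_injOn huf, ← Finset.card_image_of_injOn hug]
  exact Finset.card_le_card (Finset.image_subset_image hus)

theorem card_image_congr {ι β γ : Type*} [DecidableEq β] [DecidableEq γ]
    {s : Finset ι} {f : ι → β} {g : ι → γ} (h : ∀ x ∈ s, ∀ y ∈ s, f x = f y ↔ g x = g y) :
    (s.image f).card = (s.image g).card :=
  (card_image_le_card_image fun x hx y hy => (h x hx y hy).2).antisymm
    (card_image_le_card_image fun x hx y hy => (h x hx y hy).1)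

end Components

/-! ### Gibbs weights, heat-bath probabilities and the Glauber dynamics. -/

section Model

variable {V : Type*} {G : SimpleGraph V}

theorem Config.graph_adj {A : Config G} {x y : V} :
    A.graph.Adj x y ↔ ∃ h : s(x, y) ∈ G.edgeSet, (⟨s(x, y), h⟩ : G.edgeSet) ∈ A := by
  rw [Config.graph, SimpleGraph.fromEdgeSet_adj, Set.mem_ofPred_eq, and_iff_left_iff_imp]
  rintro ⟨h, -⟩
  exact G.ne_of_adj h

theorem Config.graph_mono {A B : Config G} (h : A ⊆ B) : A.graph ≤ B.graph := fun x y hxy => by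
  rw [Config.graph_adj] at *
  exact hxy.imp fun _ h' => h h'

theorem numComponents_le_card [Fintype V] (A : Config G) : A.numComponents ≤ Fintype.card V := by
  rw [← Nat.card_eq_fintype_card]
  exact Nat.card_le_card_of_surjective A.graph.connectedComponentMk
    (SimpleGraph.ConnectedComponent.ind fun v => ⟨v, rfl⟩)

section Gibbs

variable [Fintype V] [DecidableRel G.Adj] {p q : ℝ}

theorem weight_pos (hp : 0 < p) (hp1 : p < 1) (hq : 1 < q) (A : Config G) :
    0 < weight G p q A := by
  have := sub_pos.2 hp1
  unfold weight
  positivity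

theorem card_mul_one_div [Nonempty G.edgeSet] :
    (Fintype.card G.edgeSet : ℝ) * (1 / (Fintype.card G.edgeSet : ℝ)) = 1 :=
  mul_one_div_cancel (by exact_mod_cast Fintype.card_ne_zero)

theorem partitionFunction_pos (hp : 0 < p) (hp1 : p < 1) (hq : 1 < q) :
    0 < partitionFunction G p q :=
  Finset.sum_pos (fun A _ => weight_pos hp hp1 hq A) Finset.univ_nonempty

theorem gibbs_pos (hp : 0 < p) (hp1 : p < 1) (hq : 1 < q) (A : Config G) : 0 < gibbs G p q A :=
  div_pos (weight_pos hp hp1 hq A) (partitionFunction_pos hp hp1 hq)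

theorem sum_gibbs (hp : 0 < p) (hp1 : p < 1) (hq : 1 < q) : ∑ A, gibbs G p q A = 1 := by
  unfold gibbs
  rw [← Finset.sum_div]
  exact div_self (partitionFunction_pos hp hp1 hq).ne'

theorem partitionFunction_le (hp : 0 < p) (hp1 : p < 1) (hq : 1 < q) :
    partitionFunction G p q ≤ q ^ Fintype.card V := by
  have h := Fintype.sum_pow_mul_eq_add_pow G.edgeSet p (1 - p)
  rw [add_sub_cancel, one_pow] at h
  calc partitionFunction G p q
      ≤ ∑ A : Config G, p ^ A.card * (1 - p) ^ (Fintype.card G.edgeSet - A.card)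
          * q ^ Fintype.card V := by
        refine Finset.sum_le_sum fun A _ => ?_
        have := sub_pos.2 hp1
        exact mul_le_mul_of_nonneg_left
          (pow_le_pow_right₀ hq.le (numComponents_le_card A)) (by positivity)
    _ = q ^ Fintype.card V := by rw [← Finset.sum_mul, h, one_mul]

theorem le_gibbs (hp : 0 < p) (hp1 : p < 1) (hq : 1 < q) (A : Config G) :
    p ^ A.card * (1 - p) ^ Fintype.card G.edgeSet / q ^ Fintype.card V ≤ gibbs G p q A := by
  have h1 := sub_pos.2 hp1
  have h2 : (1 - p) ^ Fintype.card G.edgeSet ≤ (1 - p) ^ (Fintype.card G.edgeSet - A.card) :=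
    pow_le_pow_of_le_one h1.le (by linarith) (Nat.sub_le _ _)
  refine div_le_div₀ (weight_pos hp hp1 hq A).le ?_ (partitionFunction_pos hp hp1 hq)
    (partitionFunction_le hp hp1 hq)
  calc p ^ A.card * (1 - p) ^ Fintype.card G.edgeSet
      ≤ p ^ A.card * (1 - p) ^ (Fintype.card G.edgeSet - A.card) := by gcongr
    _ ≤ weight G p q A := le_mul_of_one_le_right (by positivity) (one_le_pow₀ hq.le)

end Gibbs

variable [DecidableEq V]

theorem Config.erase_graph_le (A : Config G) (e : G.edgeSet) :
    Config.graph (A.erase e) ≤ Config.graph (insert e A) :=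
  Config.graph_mono ((Finset.erase_subset _ _).trans (Finset.subset_insert _ _))

theorem Config.insert_graph_adj {A : Config G} {e : G.edgeSet} {x y : V}
    (h : (Config.graph (insert e A)).Adj x y) :
    (Config.graph (A.erase e)).Adj x y ∨ s(x, y) = e := by
  rw [Config.graph_adj] at *
  obtain ⟨h1, h2⟩ := h
  by_cases he : s(x, y) = e
  · exact Or.inr he
  · refine Or.inl ⟨h1, ?_⟩
    have : (⟨s(x, y), h1⟩ : G.edgeSet) ≠ e := fun h3 => he (congrArg Subtype.val h3)
    exact Finset.mem_erase.2 ⟨this, (Finset.mem_insert.1 h2).resolve_left this⟩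

theorem card_insert_eq (A : Config G) (e : G.edgeSet) :
    (insert e A).card = (A.erase e).card + 1 := by
  rw [← Finset.card_insert_of_notMem (Finset.notMem_erase e A), insert_erase']

variable [Fintype V]

theorem numComponents_insert_le (A : Config G) (e : G.edgeSet) :
    Config.numComponents (insert e A) ≤ Config.numComponents (A.erase e) :=
  card_connectedComponent_anti (Config.erase_graph_le A e)

theorem numComponents_erase_le (A : Config G) (e : G.edgeSet) :
    Config.numComponents (A.erase e) ≤ Config.numComponents (insert e A) + 1 := by
  obtain ⟨u, v, huv⟩ : ∃ u v, (e : Sym2 V) = s(u, v) := by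
    induction h : (e : Sym2 V) using Sym2.ind with | h u v => exact ⟨u, v, rfl⟩
  refine card_connectedComponent_le_add_one (Config.erase_graph_le A e) (u := u) (v := v)
    fun x y h => ?_
  rw [← huv]
  exact Config.insert_graph_adj h

variable [DecidableRel G.Adj] {p q : ℝ}

/-- The two weights share a factor `X`; only `p` against `1 - p` and the component counts matter in
ratios. -/
theorem exists_gibbs_eq (hp : 0 < p) (hp1 : p < 1) (hq : 1 < q) (A : Config G) (e : G.edgeSet) :
    ∃ X > 0, gibbs G p q (insert e A) = p * X * q ^ Config.numComponents (insert e A) ∧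
      gibbs G p q (A.erase e) = (1 - p) * X * q ^ Config.numComponents (A.erase e) := by
  have h1 := sub_pos.2 hp1
  have hZ := partitionFunction_pos (G := G) hp hp1 hq
  have hm : (insert e A).card ≤ Fintype.card G.edgeSet := Finset.card_le_univ _
  refine ⟨p ^ (A.erase e).card * (1 - p) ^ (Fintype.card G.edgeSet - (insert e A).card)
    / partitionFunction G p q, by positivity, ?_, ?_⟩
  · rw [gibbs, weight, card_insert_eq, pow_succ]; ring
  · have : Fintype.card G.edgeSet - (A.erase e).card
        = Fintype.card G.edgeSet - (insert e A).card + 1 := by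
      rw [card_insert_eq] at *; omega
    rw [gibbs, weight, this, pow_succ]; ring

section HeatBath

theorem heatBath_isCondProb (hp : 0 < p) (hp1 : p < 1) (hq : 1 < q) (e : G.edgeSet) :
    IsCondProb e (gibbs G p q) (fun A => heatBathProb G p q A e) where
  insert_eq A := by simp [heatBathProb]
  erase_eq A := by simp [heatBathProb, insert_erase']
  ratio A := by
    have h1 := gibbs_pos hp hp1 hq (insert e A)
    have h2 := gibbs_pos hp hp1 hq (A.erase e)
    unfold heatBathProb
    field_simp
    ring

/-- The second value occurs exactly when removing `e` splits a component. -/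
theorem heatBathProb_cases (hp : 0 < p) (hp1 : p < 1) (hq : 1 < q) (A : Config G)
    (e : G.edgeSet) :
    heatBathProb G p q A e = p ∨ heatBathProb G p q A e = p / (p + (1 - p) * q) := by
  obtain ⟨X, hX, h1, h2⟩ := exists_gibbs_eq hp hp1 hq A e
  have h3 := sub_pos.2 hp1
  have hq0 : 0 < q := by linarith
  have hc : Config.numComponents (A.erase e) = Config.numComponents (insert e A) ∨
      Config.numComponents (A.erase e) = Config.numComponents (insert e A) + 1 := by
    have := numComponents_insert_le A e
    have := numComponents_erase_le A e
    omega
  unfold heatBathProb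
  rw [h1, h2]
  rcases hc with hc | hc
  · left; rw [hc]; field_simp; ring
  · right; rw [hc, pow_succ]; field_simp

theorem heatBathProb_bounds (hp : 0 < p) (hp1 : p < 1) (hq : 1 < q) (A : Config G)
    (e : G.edgeSet) : 0 ≤ heatBathProb G p q A e ∧ heatBathProb G p q A e ≤ p ∧
      p * (1 - p) ≤ q * (heatBathProb G p q A e * (1 - heatBathProb G p q A e)) := by
  have h3 := sub_pos.2 hp1
  have h4 : 0 < p * (1 - p) := mul_pos hp h3
  rcases heatBathProb_cases hp hp1 hq A e with h | h <;> rw [h]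
  · exact ⟨hp.le, le_rfl, by nlinarith⟩
  · have hq0 : 0 < q := by linarith
    have hd : 0 < p + (1 - p) * q := by positivity
    have hd1 : 1 ≤ p + (1 - p) * q := by nlinarith
    have hdq : p + (1 - p) * q ≤ q := by nlinarith
    refine ⟨by positivity, div_le_self hp.le hd1, ?_⟩
    have : q * (p / (p + (1 - p) * q) * (1 - p / (p + (1 - p) * q)))
        -- The denominator `p + (1 - p) * q` is at most `q`, so the last factor is at least `1`.
        = p * (1 - p) * (q ^ 2 / (p + (1 - p) * q) ^ 2) := by
      field_simp; ring
    rw [this]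
    refine le_mul_of_one_le_right h4.le ?_
    rw [one_le_div (by positivity)]
    gcongr

end HeatBath

section Glauber

open Matrix

theorem glauber_mulVec (f : Config G → ℝ) (A : Config G) :
    (glauber G p q *ᵥ f) A = ∑ e : G.edgeSet, 1 / (Fintype.card G.edgeSet : ℝ)
      * upd e (fun A => heatBathProb G p q A e) f A := by
  simp only [mulVec, dotProduct, glauber, Finset.sum_mul]
  rw [Finset.sum_comm]
  refine Finset.sum_congr rfl fun e _ => ?_
  simp only [mul_assoc, ← Finset.mul_sum, add_mul, Finset.sum_add_distrib, ite_mul, zero_mul,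
    Finset.sum_ite_eq', Finset.mem_univ, if_true, upd]

theorem ip_glauber (π f g : Config G → ℝ) :
    ip π f (glauber G p q *ᵥ g) = ∑ e : G.edgeSet, 1 / (Fintype.card G.edgeSet : ℝ)
      * ip π f (upd e (fun A => heatBathProb G p q A e) g) := by
  simp only [ip, glauber_mulVec, Finset.mul_sum]
  rw [Finset.sum_comm]
  exact Finset.sum_congr rfl fun e _ => Finset.sum_congr rfl fun A _ => by ring

variable [Nonempty G.edgeSet]

theorem glauber_isReversible (hp : 0 < p) (hp1 : p < 1) (hq : 1 < q) :
    IsReversible (glauber G p q) (gibbs G p q) where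
  nonneg A B := by
    refine Finset.sum_nonneg fun e _ => mul_nonneg (by positivity) ?_
    obtain ⟨h1, h2, -⟩ := heatBathProb_bounds hp hp1 hq A e
    split_ifs <;> linarith
  row_sum A := by
    have h := glauber_mulVec (p := p) (q := q) (fun _ => 1) A
    simp only [mulVec, dotProduct, mul_one] at h
    rw [h]
    simp only [upd, mul_one, add_sub_cancel, Finset.sum_const, Finset.card_univ, nsmul_eq_mul]
    rw [card_mul_one_div]
  pos := gibbs_pos hp hp1 hq
  sum_eq_one := sum_gibbs hp hp1 hq
  balance := balance_of_ip_comm fun f g => by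
    have hs : ∀ a b : Config G → ℝ, ip (gibbs G p q) a b = ip (gibbs G p q) b a := fun a b =>
      Finset.sum_congr rfl fun A _ => by rw [mul_comm (a A)]
    rw [hs _ g, ip_glauber, ip_glauber]
    refine Finset.sum_congr rfl fun e _ => ?_
    rw [ip_upd_comm (heatBath_isCondProb hp hp1 hq e), hs]

/-- The Dirichlet form of the Glauber dynamics. -/
theorem glauber_dirichlet (hp : 0 < p) (hp1 : p < 1) (hq : 1 < q) (f : Config G → ℝ) :
    ip (gibbs G p q) f f - ip (gibbs G p q) f (glauber G p q *ᵥ f)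
      = ∑ e : G.edgeSet, 1 / (Fintype.card G.edgeSet : ℝ) * ∑ A, gibbs G p q A *
        (heatBathProb G p q A e * (1 - heatBathProb G p q A e) * (grad e f A * grad e f A)) := by
  have h : ip (gibbs G p q) f f = ∑ e : G.edgeSet, 1 / (Fintype.card G.edgeSet : ℝ)
      * ip (gibbs G p q) f f := by
    rw [Finset.sum_const, Finset.card_univ, nsmul_eq_mul, ← mul_assoc, card_mul_one_div, one_mul]
  rw [ip_glauber]
  nth_rw 1 [h]
  rw [← Finset.sum_sub_distrib]
  refine Finset.sum_congr rfl fun e _ => ?_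
  rw [← mul_sub, ip_sub_upd (heatBath_isCondProb hp hp1 hq e)]

/-- The Glauber dynamics is an average of projections. -/
theorem glauber_ip_self_le (hp : 0 < p) (hp1 : p < 1) (hq : 1 < q) (f : Config G → ℝ) :
    ip (gibbs G p q) (glauber G p q *ᵥ f) (glauber G p q *ᵥ f)
      ≤ ip (gibbs G p q) f (glauber G p q *ᵥ f) := by
  set m : ℝ := (Fintype.card G.edgeSet : ℝ) with hm
  have hm0 : 0 < m := by rw [hm]; exact_mod_cast Fintype.card_pos
  set u : G.edgeSet → Config G → ℝ := fun e => upd e (fun A => heatBathProb G p q A e) f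
  have hpt : ∀ A, (glauber G p q *ᵥ f) A * (glauber G p q *ᵥ f) A
      ≤ ∑ e, 1 / m * (u e A * u e A) := fun A => by
    have h1 : (∑ e, u e A) ^ 2 ≤ m * ∑ e, u e A ^ 2 := by
      have := sq_sum_le_card_mul_sum_sq (s := Finset.univ) (f := fun e => u e A)
      simpa [hm] using this
    rw [glauber_mulVec, ← Finset.mul_sum, ← Finset.mul_sum]
    have h2 : 1 / m * (∑ e, u e A) * (1 / m * ∑ e, u e A) = (∑ e, u e A) ^ 2 / (m * m) := by
      field_simp
    have h3 : 1 / m * ∑ e, u e A * u e A = (m * ∑ e, u e A ^ 2) / (m * m) := by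
      simp only [sq]; field_simp
    change 1 / m * (∑ e, u e A) * (1 / m * ∑ e, u e A) ≤ _
    rw [h2, h3]
    gcongr
  calc ip (gibbs G p q) (glauber G p q *ᵥ f) (glauber G p q *ᵥ f)
      ≤ ∑ A, gibbs G p q A * ∑ e, 1 / m * (u e A * u e A) :=
        Finset.sum_le_sum fun A _ => mul_le_mul_of_nonneg_left (hpt A) (gibbs_pos hp hp1 hq A).le
    _ = ∑ e, 1 / m * ip (gibbs G p q) (u e) (u e) := by
        simp only [ip, Finset.mul_sum]
        rw [Finset.sum_comm]
        exact Finset.sum_congr rfl fun e _ => Finset.sum_congr rfl fun A _ => by ring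
    _ = ip (gibbs G p q) f (glauber G p q *ᵥ f) := by
        rw [ip_glauber]
        exact Finset.sum_congr rfl fun e _ => by
          rw [ip_upd_upd (heatBath_isCondProb hp hp1 hq e)]

/-- The expected change of the number of edges in one step of the Glauber dynamics. -/
theorem glauber_card_le (hp : 0 < p) (hp1 : p < 1) (hq : 1 < q) (A : Config G) :
    (glauber G p q *ᵥ fun B => (B.card : ℝ)) A
      ≤ (1 - 1 / (Fintype.card G.edgeSet : ℝ)) * A.card
        + (1 - (1 - 1 / (Fintype.card G.edgeSet : ℝ))) * (p * Fintype.card G.edgeSet) := by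
  set m : ℝ := (Fintype.card G.edgeSet : ℝ) with hm
  have hm0 : 0 < m := by rw [hm]; exact_mod_cast Fintype.card_pos
  -- An update of `e` first deletes it, then restores it with probability at most `p`, whatever the
  -- rest of `A`.
  have h1 : ∀ e : G.edgeSet, upd e (fun A => heatBathProb G p q A e) (fun B => (B.card : ℝ)) A
      ≤ A.card - (if e ∈ A then 1 else 0) + p := fun e => by
    have h2 := (heatBathProb_bounds hp hp1 hq A e).2.1
    have h3 : ((A.erase e).card : ℝ) = A.card - (if e ∈ A then 1 else 0) := by
      split_ifs with he
      · rw [← Finset.card_erase_add_one he]; push_cast; ring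
      · rw [Finset.erase_eq_of_notMem he, sub_zero]
    simp only [upd]
    rw [← h3, card_insert_eq]
    push_cast
    linarith
  rw [glauber_mulVec, ← Finset.mul_sum]
  have h4 := Finset.sum_le_sum fun e (_ : e ∈ Finset.univ) => h1 e
  have h5 : ∑ e : G.edgeSet, ((A.card : ℝ) - (if e ∈ A then 1 else 0) + p)
      = m * A.card - A.card + m * p := by
    rw [Finset.sum_add_distrib, Finset.sum_sub_distrib]
    simp [hm]
  rw [h5] at h4
  calc _ ≤ 1 / m * (m * A.card - A.card + m * p) := by
        gcongr
    _ = _ := by field_simp; ring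

end Glauber

end Model

/-! ### Chayes–Machta dynamics and comparison of Dirichlet forms. -/

section ChayesMachta

variable {V : Type*} {G : SimpleGraph V}

/-- No edge of the configuration crosses from `U` to its complement: `U` is a union of connected
components. -/
def IsUnionOfComponents (A : Config G) (U : Finset V) : Prop :=
  ∀ x y, A.graph.Adj x y → x ∈ U → y ∈ U

theorem IsUnionOfComponents.mem_of_reachable {A : Config G} {U : Finset V}
    (h : IsUnionOfComponents A U) {x y : V} (hxy : A.graph.Reachable x y) (hx : x ∈ U) :
    y ∈ U := by
  obtain ⟨w⟩ := hxy
  induction w with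
  | nil => exact hx
  | cons hadj _ ih => exact ih (h _ _ hadj hx)

/-- The edges of `G` with both endpoints in `U`. -/
def edgesInside [Fintype V] [DecidableEq V] [DecidableRel G.Adj] (U : Finset V) :
    Finset G.edgeSet :=
  Finset.univ.filter fun e => ∀ v ∈ (e : Sym2 V), v ∈ U

variable [Fintype V] [DecidableEq V]

open Classical in
/-- The number of components of `(V, A)` that meet `U`. -/
noncomputable def numMeeting (A : Config G) (U : Finset V) : ℕ :=
  (U.image A.graph.connectedComponentMk).card

open Classical in
/-- The probability that `U` is the set of active vertices. -/
noncomputable def activationProb (q : ℝ) (A : Config G) (U : Finset V) : ℝ :=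
  if IsUnionOfComponents A U then
    (1 / q) ^ numMeeting A U * (1 - 1 / q) ^ numMeeting A Uᶜ else 0

theorem activationProb_nonneg {q : ℝ} (hq : 1 < q) (A : Config G) (U : Finset V) :
    0 ≤ activationProb q A U := by
  have : 0 ≤ 1 - 1 / q := by rw [sub_nonneg, div_le_one (by linarith)]; exact hq.le
  have : 0 < q := by linarith
  unfold activationProb
  split_ifs <;> positivity

theorem numComponents_eq {A : Config G} {U : Finset V} (h : IsUnionOfComponents A U) :
    A.numComponents = numMeeting A U + numMeeting A Uᶜ := by
  classical
  rw [numMeeting, numMeeting, ← Finset.card_union_of_disjoint, ← Finset.image_union,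
    Finset.union_compl, Config.numComponents, Nat.card_eq_fintype_card, ← Finset.card_univ]
  · congr 1
    ext c
    induction c using SimpleGraph.ConnectedComponent.ind with | h v
    simpa using ⟨v, SimpleGraph.Reachable.refl v⟩
  · rw [Finset.disjoint_left]
    intro c hc hc'
    obtain ⟨x, hx, rfl⟩ := Finset.mem_image.1 hc
    obtain ⟨y, hy, hxy⟩ := Finset.mem_image.1 hc'
    exact Finset.mem_compl.1 hy (h.mem_of_reachable
      (SimpleGraph.ConnectedComponent.eq.1 hxy.symm) hx)

variable [DecidableRel G.Adj]

-- Indexing by vertex sets `U` instead of sets of components of `A` makes the index type independent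
-- of `A`, so the sums over `A` and `U` can be exchanged.
open Classical in
theorem sum_activation (q : ℝ) (A : Config G) (Φ : Finset G.edgeSet → ℝ) :
    ∑ S : Finset A.graph.ConnectedComponent,
      (1 / q) ^ S.card * (1 - 1 / q) ^ Sᶜ.card * Φ (activeEdges A S)
      = ∑ U : Finset V, activationProb q A U * Φ (edgesInside U) := by
  simp only [activationProb, ite_mul, zero_mul]
  rw [← Finset.sum_filter]
  have himg : ∀ S : Finset A.graph.ConnectedComponent,
      (Finset.univ.filter fun v => A.graph.connectedComponentMk v ∈ S).image
        A.graph.connectedComponentMk = S := fun S => by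
    ext c
    induction c using SimpleGraph.ConnectedComponent.ind with | h v
    simp only [Finset.mem_image, Finset.mem_filter, Finset.mem_univ, true_and]
    exact ⟨fun ⟨x, hx, hxv⟩ => hxv ▸ hx, fun hv => ⟨v, hv, rfl⟩⟩
  refine Finset.sum_bij' (fun S _ => Finset.univ.filter fun v =>
    A.graph.connectedComponentMk v ∈ S) (fun U _ => U.image A.graph.connectedComponentMk)
    ?_ ?_ ?_ ?_ ?_
  · intro S _
    rw [Finset.mem_filter]
    refine ⟨Finset.mem_univ _, fun x y hxy hx => ?_⟩
    rw [Finset.mem_filter] at hx ⊢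
    refine ⟨Finset.mem_univ _, ?_⟩
    rw [← SimpleGraph.ConnectedComponent.sound hxy.reachable]
    exact hx.2
  · exact fun _ _ => Finset.mem_univ _
  · exact fun S _ => himg S
  · intro U hU
    have hU := (Finset.mem_filter.1 hU).2
    ext v
    simp only [Finset.mem_filter, Finset.mem_univ, true_and, Finset.mem_image]
    refine ⟨fun ⟨x, hx, hxv⟩ => hU.mem_of_reachable (SimpleGraph.ConnectedComponent.eq.1 hxv) hx,
      fun hv => ⟨v, hv, rfl⟩⟩
  · intro S _
    have h1 : numMeeting A (Finset.univ.filter fun v => A.graph.connectedComponentMk v ∈ S)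
        = S.card := by rw [numMeeting]; convert congrArg Finset.card (himg S)
    have h2 : numMeeting A (Finset.univ.filter fun v => A.graph.connectedComponentMk v ∈ S)ᶜ
        = Sᶜ.card := by
      rw [numMeeting, Finset.compl_filter]
      convert congrArg Finset.card (himg Sᶜ) using 4
      simp
    rw [h1, h2]
    congr 2
    ext e
    simp [activeEdges, edgesInside]

theorem sum_activationProb (q : ℝ) (A : Config G) : ∑ U, activationProb q A U = 1 := by
  classical
  have h := sum_activation q A fun _ => 1
  simp only [mul_one] at h
  rw [← h]
  have h2 := Fintype.sum_pow_mul_eq_add_pow A.graph.ConnectedComponent (1 / q) (1 - 1 / q)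
  rw [add_sub_cancel, one_pow] at h2
  refine Eq.trans (Finset.sum_congr rfl fun S _ => ?_) h2
  rw [Finset.card_compl]

open Matrix

variable {p q : ℝ}

theorem chayesMachta_apply (A B : Config G) : chayesMachta G p q A B
    = ∑ U, activationProb q A U * percolationProb p (edgesInside U) A B := by
  rw [← sum_activation q A fun F => percolationProb p F A B]
  rfl

theorem chayesMachta_mulVec (f : Config G → ℝ) (A : Config G) : (chayesMachta G p q *ᵥ f) A
    = ∑ U, activationProb q A U * percOp p (edgesInside U) f A := by
  simp only [mulVec, dotProduct, chayesMachta_apply, percOp, Finset.mul_sum, Finset.sum_mul,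
    mul_assoc]
  rw [Finset.sum_comm]

theorem ip_chayesMachta (π f g : Config G → ℝ) : ip π f (chayesMachta G p q *ᵥ g)
    = ∑ U, ip (fun A => π A * activationProb q A U) f (percOp p (edgesInside U) g) := by
  simp only [ip, chayesMachta_mulVec, Finset.mul_sum]
  rw [Finset.sum_comm]
  exact Finset.sum_congr rfl fun U _ => Finset.sum_congr rfl fun A _ => by ring

theorem ip_eq_sum_activation (q : ℝ) (π f g : Config G → ℝ) : ip π f g
    = ∑ U, ip (fun A => π A * activationProb q A U) f g := by
  simp only [ip]
  rw [Finset.sum_comm]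
  refine Finset.sum_congr rfl fun A _ => ?_
  rw [← Finset.sum_mul, ← Finset.mul_sum, sum_activationProb, mul_one]

theorem erase_adj_of_notMem {U : Finset V} {e : G.edgeSet} (he : e ∈ edgesInside U)
    {A : Config G} {x y : V} (h : (Config.graph (insert e A)).Adj x y) (hx : x ∉ U) :
    (Config.graph (A.erase e)).Adj x y := by
  refine (Config.insert_graph_adj h).resolve_right fun hxy => hx ?_
  exact (Finset.mem_filter.1 he).2 x (hxy ▸ Sym2.mem_mk_left x y)

theorem isUnionOfComponents_insert_iff {U : Finset V} {e : G.edgeSet} (he : e ∈ edgesInside U)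
    (A : Config G) : IsUnionOfComponents (insert e A) U ↔ IsUnionOfComponents (A.erase e) U := by
  refine ⟨fun h x y hxy => h x y (Config.erase_graph_le A e hxy), fun h x y hxy hx => ?_⟩
  by_contra hy
  exact hy (h x y (erase_adj_of_notMem he hxy.symm hy).symm hx)

theorem reachable_erase_of_notMem {U : Finset V} {e : G.edgeSet} (he : e ∈ edgesInside U)
    {A : Config G} (hU : IsUnionOfComponents (insert e A) U) {x y : V}
    (h : (Config.graph (insert e A)).Reachable x y) (hx : x ∉ U) :
    (Config.graph (A.erase e)).Reachable x y := by
  obtain ⟨w⟩ := h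
  induction w with
  | nil => exact SimpleGraph.Reachable.refl _
  | cons hadj _ ih =>
    exact (erase_adj_of_notMem he hadj hx).reachable.trans
      (ih fun hz => hx (hU _ _ hadj.symm hz))

theorem numMeeting_compl_insert {U : Finset V} {e : G.edgeSet} (he : e ∈ edgesInside U)
    {A : Config G} (hU : IsUnionOfComponents (insert e A) U) :
    numMeeting (insert e A) Uᶜ = numMeeting (A.erase e) Uᶜ := by
  classical
  refine card_image_congr fun x hx y _ => ?_
  rw [SimpleGraph.ConnectedComponent.eq, SimpleGraph.ConnectedComponent.eq]
  exact ⟨fun h => reachable_erase_of_notMem he hU h (Finset.mem_compl.1 hx),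
    fun h => h.mono (Config.erase_graph_le A e)⟩

/-- For a union `U` of components, `q ^ c(A)` times the activation probability is `(q - 1) ^ b`,
where `b` counts the components outside `U`. An edge inside `U` changes neither `b` nor whether `U`
is a union of components, so only the factors `p` and `1 - p` remain. -/
theorem activation_isCondProb (hp : 0 < p) (hp1 : p < 1) (hq : 1 < q) {U : Finset V}
    {e : G.edgeSet} (he : e ∈ edgesInside U) :
    IsCondProb e (fun A => gibbs G p q A * activationProb q A U) (fun _ => p) where
  insert_eq _ := rfl
  erase_eq _ := rfl
  ratio A := by
    have hq0 : q ≠ 0 := by linarith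
    by_cases hU : IsUnionOfComponents (insert e A) U
    · have hU' := (isUnionOfComponents_insert_iff he A).1 hU
      obtain ⟨X, -, h1, h2⟩ := exists_gibbs_eq hp hp1 hq A e
      have key : ∀ a b : ℕ, q ^ (a + b) * ((1 / q) ^ a * (1 - 1 / q) ^ b) = (q - 1) ^ b :=
        fun a b => by
          rw [pow_add, mul_mul_mul_comm, ← mul_pow, ← mul_pow, mul_one_div_cancel hq0, one_pow,
            one_mul, mul_sub, mul_one, mul_one_div_cancel hq0]
      rw [activationProb, activationProb, if_pos hU, if_pos hU', h1, h2, mul_assoc (p * X),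
        mul_assoc ((1 - p) * X), numComponents_eq hU, numComponents_eq hU', key, key,
        numMeeting_compl_insert he hU]
      ring
    · have hU' := fun h => hU ((isUnionOfComponents_insert_iff he A).2 h)
      rw [activationProb, activationProb, if_neg hU, if_neg hU']
      ring

theorem chayesMachta_isReversible (hp : 0 < p) (hp1 : p < 1) (hq : 1 < q) :
    IsReversible (chayesMachta G p q) (gibbs G p q) where
  nonneg A B := by
    rw [chayesMachta_apply]
    exact Finset.sum_nonneg fun U _ => mul_nonneg (activationProb_nonneg hq A U)
      (percolationProb_nonneg hp.le hp1.le _ A B)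
  row_sum A := by
    simp only [chayesMachta_apply]
    rw [Finset.sum_comm]
    simp only [← Finset.mul_sum, sum_percolationProb, mul_one, sum_activationProb]
  pos := gibbs_pos hp hp1 hq
  sum_eq_one := sum_gibbs hp hp1 hq
  balance := balance_of_ip_comm fun f g => by
    have hs : ∀ a b : Config G → ℝ, ip (gibbs G p q) a b = ip (gibbs G p q) b a := fun a b =>
      Finset.sum_congr rfl fun A _ => by rw [mul_comm (a A)]
    rw [hs _ g, ip_chayesMachta, ip_chayesMachta]
    refine Finset.sum_congr rfl fun U _ => ?_
    rw [ip_percOp_comm fun e he => activation_isCondProb hp hp1 hq he]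
    exact Finset.sum_congr rfl fun A _ => by rw [mul_comm (g A)]

/-- Comparison of the Dirichlet forms of the two dynamics. -/
theorem chayesMachta_dirichlet_le [Nonempty G.edgeSet] (hp : 0 < p) (hp1 : p < 1) (hq : 1 < q)
    (f : Config G → ℝ) :
    ip (gibbs G p q) f f - ip (gibbs G p q) f (chayesMachta G p q *ᵥ f)
      ≤ q * Fintype.card G.edgeSet *
        (ip (gibbs G p q) f f - ip (gibbs G p q) f (glauber G p q *ᵥ f)) := by
  have hp1' := sub_pos.2 hp1
  have hr : ∀ U A, 0 ≤ gibbs G p q A * activationProb q A U := fun U A =>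
    mul_nonneg (gibbs_pos hp hp1 hq A).le (activationProb_nonneg hq A U)
  calc ip (gibbs G p q) f f - ip (gibbs G p q) f (chayesMachta G p q *ᵥ f)
      = ∑ U, (ip (fun A => gibbs G p q A * activationProb q A U) f f
          - ip (fun A => gibbs G p q A * activationProb q A U) f
            (percOp p (edgesInside U) f)) := by
        rw [Finset.sum_sub_distrib, ← ip_eq_sum_activation, ← ip_chayesMachta]
    _ ≤ ∑ U, ∑ e : G.edgeSet, ∑ A, gibbs G p q A * activationProb q A U
          * (p * (1 - p) * (grad e f A * grad e f A)) := by
        refine Finset.sum_le_sum fun U _ => (ip_sub_percOp_le hp.le hp1.le (hr U)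
          (fun e he => activation_isCondProb hp hp1 hq he) f).trans ?_
        refine Finset.sum_le_sum_of_subset_of_nonneg (Finset.subset_univ _) fun e _ _ =>
          Finset.sum_nonneg fun A _ => mul_nonneg (hr U A) (mul_nonneg (by positivity)
            (mul_self_nonneg _))
    _ = ∑ e : G.edgeSet, ∑ A, gibbs G p q A * (p * (1 - p) * (grad e f A * grad e f A)) := by
        rw [Finset.sum_comm]
        refine Finset.sum_congr rfl fun e _ => ?_
        rw [Finset.sum_comm]
        refine Finset.sum_congr rfl fun A _ => ?_
        rw [← Finset.sum_mul, ← Finset.mul_sum, sum_activationProb, mul_one]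
    _ ≤ ∑ e : G.edgeSet, ∑ A, gibbs G p q A * (q * (heatBathProb G p q A e *
          (1 - heatBathProb G p q A e)) * (grad e f A * grad e f A)) := by
        refine Finset.sum_le_sum fun e _ => Finset.sum_le_sum fun A _ => ?_
        exact mul_le_mul_of_nonneg_left (mul_le_mul_of_nonneg_right
          (heatBathProb_bounds hp hp1 hq A e).2.2 (mul_self_nonneg _)) (gibbs_pos hp hp1 hq A).le
    _ = _ := by
        rw [glauber_dirichlet hp hp1 hq, ← Finset.mul_sum, ← mul_assoc, mul_assoc q,
          card_mul_one_div, mul_one, Finset.mul_sum]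
        refine Finset.sum_congr rfl fun e _ => ?_
        rw [Finset.mul_sum]
        exact Finset.sum_congr rfl fun A _ => by ring

/-- The Poincaré inequality for the Glauber dynamics in terms of the mixing time of the
Chayes-Machta dynamics. -/
theorem glauber_poincare [Nonempty G.edgeSet] (hp : 0 < p) (hp1 : p < 1) (hq : 1 < q) {k : ℕ}
    (hk0 : k ≠ 0) (hk : mixingTimeCM G p q ≤ k) {f : Config G → ℝ}
    (hf : ∑ A, gibbs G p q A * f A = 0) :
    ip (gibbs G p q) f f ≤ 4 * k * (q * Fintype.card G.edgeSet) *
      (ip (gibbs G p q) f f - ip (gibbs G p q) f (glauber G p q *ᵥ f)) := by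
  have hrev := chayesMachta_isReversible (G := G) hp hp1 hq
  -- Rounding `k` up to a power of two costs a factor at most `2`.
  obtain ⟨a, ha, ha2⟩ : ∃ a : ℕ, k ≤ 2 ^ a ∧ 2 ^ a ≤ 2 * k := by
    refine ⟨Nat.log 2 k + 1, (Nat.lt_pow_succ_log_self one_lt_two k).le, ?_⟩
    rw [pow_succ']
    exact Nat.mul_le_mul_left 2 (Nat.pow_log_le_self 2 hk0)
  have h1 := hrev.poincare_of_tvDist a (fun A => (hrev.tvDist_antitone A ha).trans
    (hrev.tvDist_le_of_mixingTime_le hk A)) hf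
  have h2 := chayesMachta_dirichlet_le hp hp1 hq f
  have h3 : (2 : ℝ) ^ a ≤ 2 * k := by exact_mod_cast ha2
  have h4 : 0 ≤ ip (gibbs G p q) f f - ip (gibbs G p q) f (chayesMachta G p q *ᵥ f) := by
    have := ip_self_nonneg (fun A => (gibbs_pos hp hp1 hq A).le) f
    exact nonneg_of_mul_nonneg_right (this.trans h1) (by positivity)
  calc _ ≤ _ := h1
    _ ≤ 2 * (2 * k) * (ip (gibbs G p q) f f - ip (gibbs G p q) f (chayesMachta G p q *ᵥ f)) := by
      gcongr
    _ ≤ 2 * (2 * k) * (q * Fintype.card G.edgeSet *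
        (ip (gibbs G p q) f f - ip (gibbs G p q) f (glauber G p q *ᵥ f))) := by gcongr
    _ = _ := by ring

end ChayesMachta

/-! ### Burn-in and the Gibbs mass of sparse configurations. -/

section Comparison

open Matrix

variable {V : Type*} [Fintype V] [DecidableEq V] {G : SimpleGraph V} [DecidableRel G.Adj]
  [Nonempty G.edgeSet] {p q : ℝ}

/-- After `t` burn-in steps the configuration has few edges, hence it is not too unlikely under the
random-cluster measure, and `s` further steps suffice. -/
theorem mixingTimeGD_le_add (hp : 0 < p) (hp1 : p < 1) (hq : 1 < q) {k : ℕ}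
    (hk0 : k ≠ 0) (hk : mixingTimeCM G p q ≤ k) {t s : ℕ}
    (ht : (1 - 1 / (Fintype.card G.edgeSet : ℝ)) ^ t * Fintype.card G.edgeSet ≤ 1 / 16)
    (hs : ∀ A : Config G, (A.card : ℝ) ≤ 8 * (p * Fintype.card G.edgeSet + 1 / 16) →
      (1 - 1 / (4 * k * (q * Fintype.card G.edgeSet))) ^ s ≤ 1 / 16 * gibbs G p q A) :
    mixingTimeGD G p q ≤ (t + s : ℕ) := by
  have hrev := glauber_isReversible (G := G) hp hp1 hq
  set m : ℝ := (Fintype.card G.edgeSet : ℝ) with hm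
  have hm1 : 1 ≤ m := by rw [hm]; exact_mod_cast Fintype.card_pos
  have hk1 : (1 : ℝ) ≤ k := by exact_mod_cast Nat.one_le_iff_ne_zero.2 hk0
  have hK : 1 ≤ 4 * (k : ℝ) * (q * m) := by
    have h1 : 1 ≤ q * m := by nlinarith
    nlinarith
  set c : ℝ := p * m + 1 / 16 with hc
  have hc0 : 0 < c := by positivity
  -- Markov's inequality in pointwise form: the distance is at most `1 / 8` below the threshold `8 *
  -- c` and at most `1` above it. After burn-in the mean edge count is at most `c`, so the linear
  -- term also contributes at most `1 / 8`.
  have hfar : ∀ A, tvDist ((glauber G p q ^ s) A) (gibbs G p q)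
      ≤ 1 / (8 * c) * A.card + 1 / 8 := fun A => by
    by_cases hA : (A.card : ℝ) ≤ 8 * c
    · have h1 := hrev.tvDist_pow_le hK (glauber_ip_self_le hp hp1 hq)
        (fun f hf => glauber_poincare hp hp1 hq hk0 hk hf) s A (b := 1 / 8) (by norm_num)
        ((hs A hA).trans_eq (by ring))
      have : 0 ≤ 1 / (8 * c) * (A.card : ℝ) := by positivity
      linarith
    · have h1 := (hrev.pow s).tvDist_le_one A
      have : 1 ≤ 1 / (8 * c) * (A.card : ℝ) := by
        rw [one_div_mul_eq_div, one_le_div (by positivity)]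
        exact (not_le.1 hA).le
      linarith
  refine mixingTime_le fun A => ?_
  refine (hrev.tvDist_pow_add_le t s A).trans (((hrev.pow t).mulVec_mono hfar A).trans ?_)
  have hlin : (glauber G p q ^ t *ᵥ fun B => 1 / (8 * c) * (B.card : ℝ) + 1 / 8) A
      = 1 / (8 * c) * (glauber G p q ^ t *ᵥ fun B => (B.card : ℝ)) A + 1 / 8 := by
    have h1 : (fun B : Config G => 1 / (8 * c) * (B.card : ℝ) + 1 / 8)
        = (1 / (8 * c)) • (fun B : Config G => (B.card : ℝ)) + fun _ => 1 / 8 := rfl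
    rw [h1, mulVec_add, mulVec_smul, Pi.add_apply, (hrev.pow t).mulVec_const]; rfl
  have ha : 0 ≤ 1 - 1 / m := by rw [sub_nonneg, div_le_one (by linarith)]; exact hm1
  have hdrift : (glauber G p q ^ t *ᵥ fun B => (B.card : ℝ)) A ≤ c := by
    refine (hrev.pow_mulVec_le_of_drift ha (glauber_card_le hp hp1 hq) t A).trans ?_
    have h1 : (A.card : ℝ) ≤ m := by rw [hm]; exact_mod_cast Finset.card_le_univ A
    have h2 := pow_nonneg ha t
    have h3 := mul_le_mul_of_nonneg_left h1 h2
    have h4 : 0 ≤ (1 - 1 / m) ^ t * (p * m) := by positivity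
    rw [hc]
    linarith
  rw [hlin]
  have h5 : 1 / (8 * c) * (glauber G p q ^ t *ᵥ fun B => (B.card : ℝ)) A ≤ 1 / (8 * c) * c := by
    gcongr
  have h6 : 1 / (8 * c) * c = 1 / 8 := by field_simp
  linarith

/-- A lower bound on the probability of configurations with few edges. -/
theorem exp_neg_le_gibbs {L n : ℝ} (hL : 0 < L) (hn : 96 ≤ n) (hp : 0 < p) (hpL : p * n ≤ L)
    (hp2 : p ≤ 1 / 2) (hq : 1 < q) (hV : (Fintype.card V : ℝ) = n)
    (hm : (Fintype.card G.edgeSet : ℝ) ≤ n ^ 2) {A : Config G}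
    (hA : (A.card : ℝ) ≤ 8 * (p * Fintype.card G.edgeSet + 1 / 16)) :
    Real.exp (-((3 + 2 * L + 5 * (8 * L + 1) + Real.log q) * (n * Real.log n)))
      ≤ 1 / 16 * gibbs G p q A := by
  set m : ℝ := (Fintype.card G.edgeSet : ℝ) with hmdef
  have hm0 : 0 < m := by rw [hmdef]; exact_mod_cast Fintype.card_pos
  have hn0 : 0 < n := by linarith
  have hlog : 1 ≤ Real.log n := by
    rw [Real.le_log_iff_exp_le hn0]
    linarith [Real.exp_one_lt_d9]
  have hnlog : n ≤ n * Real.log n := le_mul_of_one_le_right hn0.le hlog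
  have hp1 : 0 < 1 - p := by linarith
  have hq0 : 0 < q := by linarith
  have hpm : p * m ≤ L * n := by nlinarith
  have hlog16 : Real.log 16 ≤ 3 := by
    have : (16 : ℝ) = 2 ^ 4 := by norm_num
    rw [this, Real.log_pow]
    push_cast
    linarith [Real.log_two_lt_d9]
  have h1 : -Real.log (1 - p) * m ≤ 2 * L * n := by
    have h2 := Real.log_le_sub_one_of_pos (inv_pos.2 hp1)
    rw [Real.log_inv] at h2
    have h3 : (1 - p)⁻¹ - 1 ≤ 2 * p := by
      rw [sub_le_iff_le_add, inv_le_iff_one_le_mul₀ hp1]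
      nlinarith
    have h4 := mul_le_mul_of_nonneg_right (h2.trans h3) hm0.le
    linarith
  have h2 : (A.card : ℝ) * -Real.log p ≤ 5 * (8 * L + 1) * (n * Real.log n) := by
    rcases Nat.eq_zero_or_pos A.card with h0 | h0
    · rw [h0, Nat.cast_zero, zero_mul]; positivity
    · have h3 : (1 : ℝ) ≤ A.card := by exact_mod_cast h0
      -- A nonempty `A` below the threshold forces `8 * p * m ≥ 1 / 2`, so `p` cannot be too small.
      -- This controls `-log p` uniformly as `lam` tends to `0`; the empty configuration has no
      -- factor `p`.
      have h4 : 1 ≤ p * (16 * n ^ 2) := by nlinarith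
      have h5 : -Real.log p ≤ 5 * Real.log n := by
        have h6 := Real.log_nonneg h4
        rw [Real.log_mul hp.ne' (by positivity), Real.log_mul (by norm_num) (by positivity),
          Real.log_pow] at h6
        push_cast at h6
        linarith
      have h7 : (A.card : ℝ) ≤ (8 * L + 1) * n := by nlinarith
      calc (A.card : ℝ) * -Real.log p ≤ A.card * (5 * Real.log n) := by gcongr
        _ ≤ (8 * L + 1) * n * (5 * Real.log n) := by gcongr
        _ = _ := by ring
  have h3 : n * Real.log q ≤ Real.log q * (n * Real.log n) := by
    rw [mul_comm]
    exact mul_le_mul_of_nonneg_left hnlog (Real.log_pos hq).le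
  have hmain : Real.exp (-((3 + 2 * L + 5 * (8 * L + 1) + Real.log q) * (n * Real.log n)))
      ≤ 1 / 16 * (p ^ A.card * (1 - p) ^ Fintype.card G.edgeSet / q ^ Fintype.card V) := by
    rw [← Real.le_log_iff_exp_le (by positivity), Real.log_mul (by norm_num) (by positivity),
      one_div, Real.log_inv, Real.log_div (by positivity) (by positivity), Real.log_mul (by positivity) (by positivity),
      Real.log_pow, Real.log_pow, Real.log_pow, hV, ← hmdef]
    have h6 : 2 * L * n ≤ 2 * L * (n * Real.log n) := by gcongr
    linarith
  exact hmain.trans (mul_le_mul_of_nonneg_left (le_gibbs hp (by linarith) hq A) (by norm_num))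

end Comparison

/-! ### Choice of the running times and conclusion. -/

theorem one_sub_one_div_pow_le_exp {K : ℝ} (hK : 1 ≤ K) (s : ℕ) :
    (1 - 1 / K) ^ s ≤ Real.exp (-(s / K)) := by
  have h0 : 0 ≤ 1 - 1 / K := by rw [sub_nonneg, div_le_one (by linarith)]; exact hK
  have h1 : 1 - 1 / K ≤ Real.exp (-(1 / K)) := by
    linarith [Real.add_one_le_exp (-(1 / K))]
  calc (1 - 1 / K) ^ s ≤ Real.exp (-(1 / K)) ^ s := pow_le_pow_left₀ h0 h1 s
    _ = Real.exp (-(s / K)) := by rw [← Real.exp_nat_mul]; ring_nf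

theorem exp_neg_mul_sq_le {n : ℝ} (hn : 96 ≤ n) : Real.exp (-n) * n ^ 2 ≤ 1 / 16 := by
  -- From `exp n ≥ n ^ 3 / 6` the product is at most `6 / n`, hence the threshold `96`.
  have h := Real.pow_div_factorial_le_exp n (by linarith) 3
  norm_num [Nat.factorial] at h
  rw [Real.exp_neg, inv_mul_le_iff₀ (Real.exp_pos n)]
  nlinarith [sq_nonneg n]

theorem mixingTimeGD_le {V : Type*} [Fintype V] [DecidableEq V] {G : SimpleGraph V}
    [DecidableRel G.Adj] [Nonempty G.edgeSet] {p q L n : ℝ} (hL : 0 < L) (hn : 96 ≤ n)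
    (hp : 0 < p) (hpL : p * n ≤ L) (hp2 : p ≤ 1 / 2) (hq : 1 < q) (hV : (Fintype.card V : ℝ) = n)
    {k : ℕ} (hk0 : k ≠ 0) (hk : mixingTimeCM G p q ≤ k) :
    ∃ T : ℕ, mixingTimeGD G p q ≤ T ∧
      (T : ℝ) ≤ k * ((2 + 4 * q * (3 + 2 * L + 5 * (8 * L + 1) + Real.log q))
        * (n ^ 3 * Real.log n ^ 2)) := by
  set D : ℝ := 3 + 2 * L + 5 * (8 * L + 1) + Real.log q with hD
  have hn0 : 0 < n := by linarith
  have hlog : 1 ≤ Real.log n := by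
    rw [Real.le_log_iff_exp_le hn0]
    linarith [Real.exp_one_lt_d9]
  have hD0 : 0 < D := by
    have := Real.log_pos hq
    positivity
  have hm : (Fintype.card G.edgeSet : ℝ) ≤ n ^ 2 := by
    have h1 : Fintype.card G.edgeSet ≤ Fintype.card V ^ 2 := by
      rw [← SimpleGraph.edgeFinset_card]
      exact SimpleGraph.card_edgeFinset_le_card_choose_two.trans (Nat.choose_le_pow _ _)
    rw [← hV]
    exact_mod_cast h1
  set m : ℝ := (Fintype.card G.edgeSet : ℝ) with hmdef
  have hm1 : 1 ≤ m := by rw [hmdef]; exact_mod_cast Fintype.card_pos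
  have hk1 : (1 : ℝ) ≤ k := by exact_mod_cast Nat.one_le_iff_ne_zero.2 hk0
  set K : ℝ := 4 * k * (q * m) with hKdef
  have hK : 1 ≤ K := by
    have h1 : 1 ≤ q * m := by nlinarith
    rw [hKdef]; nlinarith
  set s : ℕ := ⌈K * (D * (n * Real.log n))⌉₊ with hs
  -- As `m ≤ n ^ 2`, a burn-in of `n ^ 3` steps gives `(1 - 1 / m) ^ (n ^ 3) ≤ exp (-n)`. The time
  -- `s` is the relaxation bound `K` times the `log (1 / μ)` bound `D * n * log n`.
  refine ⟨Fintype.card V ^ 3 + s, mixingTimeGD_le_add hp (by linarith) hq hk0 hk ?_ ?_, ?_⟩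
  · refine le_trans ?_ (exp_neg_mul_sq_le hn)
    refine mul_le_mul ((one_sub_one_div_pow_le_exp hm1 _).trans ?_) hm (by linarith)
      (Real.exp_pos _).le
    rw [Real.exp_le_exp, neg_le_neg_iff]
    push_cast
    rw [hV, le_div_iff₀ (by linarith)]
    nlinarith
  · intro A hA
    refine (one_sub_one_div_pow_le_exp hK s).trans
      (le_trans ?_ (exp_neg_le_gibbs hL hn hp hpL hp2 hq hV hm hA))
    rw [Real.exp_le_exp, neg_le_neg_iff, le_div_iff₀ (by linarith), mul_comm]
    exact Nat.le_ceil _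
  · have h1 : (s : ℝ) ≤ K * (D * (n * Real.log n)) + 1 :=
      (Nat.ceil_lt_add_one (by positivity)).le
    have hlog2 : Real.log n ≤ Real.log n ^ 2 := by nlinarith
    have hX : n ^ 3 ≤ n ^ 3 * Real.log n ^ 2 :=
      le_mul_of_one_le_right (by positivity) (by nlinarith)
    have hX1 : 1 ≤ n ^ 3 * Real.log n ^ 2 := le_trans (one_le_pow₀ (by linarith)) hX
    have hq0 : 0 < q := by linarith
    have h2 : K * (D * (n * Real.log n)) ≤ k * (4 * q * D * (n ^ 3 * Real.log n ^ 2)) := by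
      calc K * (D * (n * Real.log n)) = 4 * k * q * D * (m * n * Real.log n) := by
            rw [hKdef]; ring
        -- Only one logarithm arises; the second is slack from `log n ≥ 1`.
        _ ≤ 4 * k * q * D * (n ^ 2 * n * Real.log n ^ 2) := by gcongr
        _ = _ := by ring
    have h3 : n ^ 3 * Real.log n ^ 2 ≤ k * (n ^ 3 * Real.log n ^ 2) :=
      le_mul_of_one_le_left (by positivity) hk1
    push_cast
    rw [hV]
    linarith

end RandomCluster

theorem theorem2 (q : ℝ) (hq : 1 < q) (L : ℝ) (hL : 0 < L) :
    ∃ C : ℝ, 0 < C ∧ ∃ N : ℕ, ∀ n : ℕ, N ≤ n →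
      ∀ lam : ℝ, 0 < lam → lam ≤ L → lam < n →
        (RandomCluster.mixingTimeGD (⊤ : SimpleGraph (Fin n)) (lam / n) q : ℝ≥0∞) ≤
          (RandomCluster.mixingTimeCM (⊤ : SimpleGraph (Fin n)) (lam / n) q : ℝ≥0∞) *
            ENNReal.ofReal (C * ((n : ℝ) ^ 3 * Real.log n ^ 2)) := by
  have hlogq := Real.log_pos hq
  have hC : 0 < 2 + 4 * q * (3 + 2 * L + 5 * (8 * L + 1) + Real.log q) := by positivity
  -- The bound `n ≥ 2 * L` ensures `p ≤ 1 / 2`.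
  refine ⟨_, hC, max 96 ⌈2 * L⌉₊, fun n hn lam hlam hlamL hlamn => ?_⟩
  have hn96 : (96 : ℝ) ≤ n := by exact_mod_cast (le_max_left _ _).trans hn
  have hnL : 2 * L ≤ n := (Nat.le_ceil _).trans (by exact_mod_cast (le_max_right _ _).trans hn)
  have hn0 : (0 : ℝ) < n := by linarith
  have hlogn : 0 < Real.log n := Real.log_pos (by linarith)
  have : Nonempty (⊤ : SimpleGraph (Fin n)).edgeSet := by
    have h1 : 1 < n := by exact_mod_cast (show (1 : ℝ) < n by linarith)
    exact ⟨⟨s(⟨0, by omega⟩, ⟨1, h1⟩), by simp⟩⟩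
  have hp : 0 < lam / n := by positivity
  have hp2 : lam / n ≤ 1 / 2 := by rw [div_le_iff₀ hn0]; linarith
  have hrev := RandomCluster.chayesMachta_isReversible (G := (⊤ : SimpleGraph (Fin n))) hp
    (by linarith) hq
  induction hτ : RandomCluster.mixingTimeCM (⊤ : SimpleGraph (Fin n)) (lam / n) q with
  | top =>
    rw [ENat.toENNReal_top, ENNReal.top_mul]
    · exact le_top
    · rw [Ne, ENNReal.ofReal_eq_zero, not_le]
      positivity
  | coe k =>
    have hk0 : k ≠ 0 := by
      rintro rfl
      exact hrev.mixingTime_ne_zero hτ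
    obtain ⟨T, hT, hTle⟩ := RandomCluster.mixingTimeGD_le hL hn96 hp
      (by rwa [div_mul_cancel₀ _ hn0.ne']) hp2 hq (by simp) hk0 hτ.le
    calc (RandomCluster.mixingTimeGD (⊤ : SimpleGraph (Fin n)) (lam / n) q : ℝ≥0∞)
        ≤ ((T : ℕ∞) : ℝ≥0∞) := ENat.toENNReal_mono hT
      _ = ENNReal.ofReal T := by rw [ENat.toENNReal_coe, ENNReal.ofReal_natCast]
      _ ≤ _ := ENNReal.ofReal_le_ofReal hTle
      _ = _ := by
        rw [ENNReal.ofReal_mul (by positivity), ENNReal.ofReal_natCast, ENat.toENNReal_coe]
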